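/- Let $\phi=\frac{1+\sqrt5}{2}$, let $\xi\in\mathbb{R}$ with $-\frac{2+\sqrt5}{5}<\xi<\frac{2+\sqrt5}{27}$, and put $$f_\xi(X)=7\phi X^3-7\phi^2X^2-(11\xi+2\phi^3)X-7\xi\phi,\quad g_\xi(X)=X^3-2\phi X^2+\phi^2X-4\xi,\quad h_\xi(X)=2X^3-\phi X^2+\xi .$$ Consider the curve $$X\big(Y^2\phi^5+10f_\xi(X)g_\xi(X)\big)^2=500\,h_\xi(X)^2g_\xi(X)^3.\qquad(*)$$ **(Parametrization.)** Let $p,q,r$ be real functions on a non-empty open interval $I$ satisfying $$p'=-(5-\sqrt5)qr^5-(5+\sqrt5)q^5r+20q^3r^3-(10+10\sqrt5)p^2qr^3-(10-10\sqrt5)p^2q^3r+10p^4qr,$$ the two equations for $q'$ and $r'$ obtained from it by the cyclic permutation $p\to q\to r\to p$, and $$p^2+q^2+r^2=1,\qquad(\phi^2p^2-q^2)(\phi^2q^2-r^2)(\phi^2r^2-p^2)=\xi .$$ Put $P=\phi^2p^2-q^2$, $Q=\phi^2q^2-r^2$, $R=\phi^2r^2-p^2$. Then for each of $(X,Y)=(P,P')$,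 $(Q,Q')$, $(R,R')$ the equation $(*)$ holds identically on $I$; and if $\xi\neq0$, the pair parametrizes the curve $(*)$: the points $(X(t),Y(t))$, $t\in I$, are Zariski dense in it, in the sense that a polynomial in $\mathbb{R}[X,Y]$ vanishes at all of them if and only if it is a multiple of the difference of the two sides of $(*)$. **(Irreducibility.)** For $\xi\ne0$, the difference of the two sides of $(*)$ is a polynomial of degree $4$ in $Y$ that is irreducible over the field $\mathbb{Q}(\sqrt5,\xi)(X)$. It is also irreducible over $\mathbb{Q}(\sqrt5)(\xi,X)$ when $\xi$ is regarded as an indeterminate. **(Genus.)** For $\xi\neq0$, the equation $(*)$ defines an irreducible curve over $\mathbb{C}$, whose smooth projective model $\mathcal{C}$ has arithmetic genus $1-\chi(\mathcal{C},\mathcal{O}_{\mathcal{C}})=7$. -/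

import Mathlib

open Polynomial

namespace IcosahedralSuperflow

/-! ### The plane curve, over an arbitrary field containing the parameters `φ` and `ξ` -/

section Curve

variable {k : Type*} [Field k]

/-- `f_ξ(X) = 7φX³ - 7φ²X² - (11ξ + 2φ³)X - 7ξφ`. -/
noncomputable def fPoly (φ ξ : k) : k[X] :=
  C (7 * φ) * X ^ 3 - C (7 * φ ^ 2) * X ^ 2 - C (11 * ξ + 2 * φ ^ 3) * X - C (7 * ξ * φ)

/-- `g_ξ(X) = X³ - 2φX² + φ²X - 4ξ`. -/
noncomputable def gPoly (φ ξ : k) : k[X] :=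
  X ^ 3 - C (2 * φ) * X ^ 2 + C (φ ^ 2) * X - C (4 * ξ)

/-- `h_ξ(X) = 2X³ - φX² + ξ`. -/
noncomputable def hPoly (φ ξ : k) : k[X] :=
  2 * X ^ 3 - C φ * X ^ 2 + C ξ

/-- `X (Y² φ⁵ + 10 f_ξ(X) g_ξ(X))² - 500 h_ξ(X)² g_ξ(X)³`, as a polynomial in `Y` with
coefficients in `k[X]`. -/
noncomputable def curvePoly (φ ξ : k) : k[X][X] :=
  C X * (X ^ 2 * C (C (φ ^ 5)) + C (10 * fPoly φ ξ * gPoly φ ξ)) ^ 2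
    - C (500 * hPoly φ ξ ^ 2 * gPoly φ ξ ^ 3)

/-- The same polynomial in `Y`, with coefficients in the field `k(X)`. -/
noncomputable def curvePolyRat (φ ξ : k) : (RatFunc k)[X] :=
  (curvePoly φ ξ).map (algebraMap k[X] (RatFunc k))

end Curve

/-! ### The arithmetic genus of the smooth projective model of a plane curve

Let `F ∈ k(x)[Y]` be irreducible, `k` algebraically closed, and let `K = k(x)[Y]/(F)` be the
function field of the curve `F = 0`. The smooth projective model `𝒞` of the curve is the
normalization of the projective line in `K`. It is covered by two affine open sets, whose coordinate
rings are the integral closures in `K` of `k[x]` and of `k[1/x]`; the coordinate ring of their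
intersection is the integral closure of `k[x, 1/x]`. The cohomology of the structure sheaf is hence
computed by the Čech complex of this covering, and the arithmetic genus is `1 - χ(𝒞, 𝒪)`. -/

section Genus

variable {k : Type*} [Field k]

/-- The integral closure in `K` of the `k`-subalgebra generated by `s`, as a `k`-subspace. -/
noncomputable def integralSpace (k : Type*) {K : Type*} [Field k] [CommRing K] [Algebra k K]
    (s : Set K) : Submodule k K :=
  Subalgebra.toSubmodule ((integralClosure (Algebra.adjoin k s) K).restrictScalars k)

/-- The coordinate function `x`. -/
noncomputable def coordX (F : (RatFunc k)[X]) : AdjoinRoot F :=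
  AdjoinRoot.of F RatFunc.X

/-- The function `1/x`. -/
noncomputable def coordXInv (F : (RatFunc k)[X]) : AdjoinRoot F :=
  AdjoinRoot.of F (RatFunc.X)⁻¹

/-- Functions regular on the part of the smooth model over `x ≠ ∞`. -/
noncomputable def chartZero (F : (RatFunc k)[X]) : Submodule k (AdjoinRoot F) :=
  integralSpace k {coordX F}

/-- Functions regular on the part of the smooth model over `x ≠ 0`. -/
noncomputable def chartInfty (F : (RatFunc k)[X]) : Submodule k (AdjoinRoot F) :=
  integralSpace k {coordXInv F}

/-- Functions regular on the part of the smooth model over `x ≠ 0, ∞`. -/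
noncomputable def chartOverlap (F : (RatFunc k)[X]) : Submodule k (AdjoinRoot F) :=
  integralSpace k {coordX F, coordXInv F}

/-- `H⁰` of the structure sheaf of the smooth projective model. -/
abbrev CechH0 (F : (RatFunc k)[X]) : Type _ :=
  ↥(chartZero F ⊓ chartInfty F)

/-- `H¹` of the structure sheaf of the smooth projective model. -/
abbrev CechH1 (F : (RatFunc k)[X]) : Type _ :=
  ↥(chartOverlap F) ⧸ (chartZero F ⊔ chartInfty F).submoduleOf (chartOverlap F)

/-- `F = 0` is an irreducible curve, and the arithmetic genus `1 - χ(𝒪)` of its smooth projective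
model is `n`. -/
def DefinesCurveOfArithmeticGenus (F : (RatFunc k)[X]) (n : ℕ) : Prop :=
  Irreducible F ∧ Module.Finite k (CechH0 F) ∧ Module.Finite k (CechH1 F) ∧
    (1 : ℤ) - ((Module.finrank k (CechH0 F) : ℤ) - (Module.finrank k (CechH1 F) : ℤ)) = n

end Genus

/-! ### The differential system -/

/-- The right-hand side of the first equation of the system; the other two are obtained from it by
cyclic permutation of the variables. -/
noncomputable def rhs (p q r : ℝ) : ℝ :=
  -(5 - √5) * q * r ^ 5 - (5 + √5) * q ^ 5 * r + 20 * q ^ 3 * r ^ 3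
    - (10 + 10 * √5) * p ^ 2 * q * r ^ 3 - (10 - 10 * √5) * p ^ 2 * q ^ 3 * r
    + 10 * p ^ 4 * q * r

/-- `(p, q, r)` is a solution, on the set `I` of times, of the differential system of the
icosahedral superflow, on the orbit with parameter `ξ`. -/
structure IsSolution (ξ : ℝ) (I : Set ℝ) (p q r : ℝ → ℝ) : Prop where
  deriv_p : ∀ t ∈ I, HasDerivAt p (rhs (p t) (q t) (r t)) t
  deriv_q : ∀ t ∈ I, HasDerivAt q (rhs (q t) (r t) (p t)) t
  deriv_r : ∀ t ∈ I, HasDerivAt r (rhs (r t) (p t) (q t)) t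
  sphere : ∀ t ∈ I, p t ^ 2 + q t ^ 2 + r t ^ 2 = 1
  orbit : ∀ t ∈ I,
    (Real.goldenRatio ^ 2 * p t ^ 2 - q t ^ 2) * (Real.goldenRatio ^ 2 * q t ^ 2 - r t ^ 2) *
      (Real.goldenRatio ^ 2 * r t ^ 2 - p t ^ 2) = ξ

/-- `φ² a² - b²`; thus `P`, `Q`, `R` are `quadDiff p q`, `quadDiff q r`, `quadDiff r p`. -/
noncomputable def quadDiff (a b : ℝ → ℝ) : ℝ → ℝ :=
  fun t => Real.goldenRatio ^ 2 * a t ^ 2 - b t ^ 2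

/-- The curve `C = 0` is parametrized by `(x, y)` on `I`: all the points `(x(t), y(t))` lie on the
curve, and they are Zariski dense in it, in the sense that every polynomial vanishing at all of them
is a multiple of `C`. -/
def Parametrizes (I : Set ℝ) (x y : ℝ → ℝ) (C : ℝ[X][X]) : Prop :=
  ∀ G : ℝ[X][X], (∀ t ∈ I, G.evalEval (x t) (y t) = 0) ↔ C ∣ G

/-! ### Fields of coefficients -/

/-- The subfield `ℚ(φ, ξ) = ℚ(√5, ξ)` of `ℝ`. -/
noncomputable abbrev coeffField (ξ : ℝ) : IntermediateField ℚ ℝ :=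
  IntermediateField.adjoin ℚ {Real.goldenRatio, ξ}

/-- `φ` as an element of `ℚ(φ, ξ)`. -/
noncomputable def phiElt (ξ : ℝ) : coeffField ξ :=
  ⟨Real.goldenRatio, IntermediateField.subset_adjoin ℚ _ (by simp)⟩

/-- `ξ` as an element of `ℚ(φ, ξ)`. -/
noncomputable def xiElt (ξ : ℝ) : coeffField ξ :=
  ⟨ξ, IntermediateField.subset_adjoin ℚ _ (by simp)⟩

/-- The field `ℚ(φ)(ξ)` of rational functions in an indeterminate `ξ` over `ℚ(φ) = ℚ(√5)`. -/
abbrev GenericField : Type :=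
  RatFunc (IntermediateField.adjoin ℚ ({Real.goldenRatio} : Set ℝ))

/-- `φ` as an element of `ℚ(φ)(ξ)`. -/
noncomputable def genericPhi : GenericField :=
  RatFunc.C ⟨Real.goldenRatio, IntermediateField.subset_adjoin ℚ _ (by simp)⟩

end IcosahedralSuperflow

/-! Behind the quartic stands the plane cubic E given by P + Q + R = φ, PQR = ξ. A solution stays on
E and, by `flow_identity`, moves along the field (P(Q - R), Q(R - P), R(P - Q)) scaled by 16√5 φ⁻¹
pqr, where 2φ - 1 = √5. With w = P(Q - R) one has w² = P g(P). On a solution, 4φ³p², 4φ³q², 4φ³r²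
are linear forms in P, Q, R, and `elliptic_norm_identity` writes their product in terms of P and w.
So P'² is a function of P and w, and eliminating w gives the curve.

Conversely, any extension of k(x) containing a root y of the quartic contains w with w² = x g and u
= xy/w with u² = (10/φ⁵)(√5 h w - x f) (`IsNondegenerate.exists_tower`). The zeros of u² with x ≠ 0
are those of the three linear forms on E. They are simple because the lines share no point of E and
can be tangent to it only if 27ξ = φ³ or 5ξ = -φ³ (`IsNondegenerate.not_tangent`). Hence the curve
in (x, w, u) is smooth, and over an algebraically closed field 1, w, u, wu is a basis of the
integral closure of k[x] (`isIntegral_tower_iff`). These four elements are independent over k(x), so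
every irreducible factor of the quartic has degree 4. Irreducibility descends to smaller fields.

Over x = ∞ the same argument applies to 1/x, w/x², u/x³. So the structure sheaf pushes forward to O
⊕ O(-2) ⊕ O(-3) ⊕ O(-5) on the projective line: H⁰ has dimension 1, and H¹ has dimension 0 + 1 + 2 +
4 = 7.

For density, a polynomial that is not a multiple of the equation can be combined with it to a
nonzero polynomial in X alone (`IsNondegenerate.exists_elimination`). If it vanished on the
trajectory, P would take finitely many values, but P has a nonzero derivative somewhere
(`IsSolution.exists_deriv_ne_zero`). -/

namespace IcosahedralSuperflow

/-! ### Smooth towers w² = G, u² = a + bw: divisibility at a point. -/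

section Tower

variable {k : Type*} [Field k]

/-- The conditions under which the affine curve `w² = G(x)`, `u² = a(x) + b(x) w` is smooth. -/
structure IsSmoothTower (G a b : k[X]) : Prop where
  simple_root : ∀ x₀, G.eval x₀ = 0 → G.derivative.eval x₀ ≠ 0
  simple_zero : ∀ x₀ w₀, w₀ ^ 2 = G.eval x₀ → a.eval x₀ + b.eval x₀ * w₀ = 0 →
    2 * a.derivative.eval x₀ * w₀ + 2 * G.eval x₀ * b.derivative.eval x₀
      + b.eval x₀ * G.derivative.eval x₀ ≠ 0

theorem eval_eq_zero_of_sq_dvd {p : k[X]} {x₀ : k} (h : (X - C x₀) ^ 2 ∣ p) :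
    p.eval x₀ = 0 ∧ p.derivative.eval x₀ = 0 := by
  obtain ⟨q, rfl⟩ := h
  simp [derivative_mul, derivative_pow]

/-- If a quadratic condition modulo `(x - x₀)²` forces divisibility by `x - x₀`, then the condition
modulo `δ²` forces divisibility by `δ`. -/
theorem dvd_and_dvd_of_forall_root [IsAlgClosed k] {Q : k[X] → k[X] → k[X] → Prop}
    (hQ : ∀ d e α β, e ≠ 0 → Q (e * d) (e * α) (e * β) → Q d α β)
    (hroot : ∀ x₀ d α β, Q ((X - C x₀) * d) α β → X - C x₀ ∣ α ∧ X - C x₀ ∣ β)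
    (δ α β : k[X]) (hδ : δ ≠ 0) (h : Q δ α β) : δ ∣ α ∧ δ ∣ β := by
  induction hn : δ.natDegree generalizing δ α β with
  | zero =>
    have : IsUnit δ := by
      rw [Polynomial.isUnit_iff_degree_eq_zero, Polynomial.degree_eq_natDegree hδ, hn]; rfl
    exact ⟨this.dvd, this.dvd⟩
  | succ n ih =>
    obtain ⟨x₀, hx⟩ := IsAlgClosed.exists_root δ (by
      rw [Polynomial.degree_eq_natDegree hδ, hn]; exact_mod_cast n.succ_ne_zero)
    obtain ⟨d, rfl⟩ := dvd_iff_isRoot.mpr hx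
    have hd : d ≠ 0 := right_ne_zero_of_mul hδ
    obtain ⟨⟨α', rfl⟩, ⟨β', rfl⟩⟩ := hroot x₀ d α β h
    have hdeg : d.natDegree = n := by
      rw [natDegree_mul (X_sub_C_ne_zero x₀) hd, natDegree_X_sub_C] at hn; omega
    obtain ⟨h1, h2⟩ := ih d α' β' hd (hQ _ _ _ _ (X_sub_C_ne_zero x₀) h) hdeg
    exact ⟨mul_dvd_mul_left _ h1, mul_dvd_mul_left _ h2⟩

/-- A simple root of G contributes only one factor x - x₀, so the second factor of the square has to
come from β. -/
theorem IsSmoothTower.dvd_of_sq_dvd_sq_mul [IsAlgClosed k] {G a b : k[X]} (h : IsSmoothTower G a b)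
    {δ β : k[X]} (hδ : δ ≠ 0) (hd : δ ^ 2 ∣ β ^ 2 * G) : δ ∣ β := by
  refine (dvd_and_dvd_of_forall_root (Q := fun δ α β => δ ^ 2 ∣ α ^ 2 * G ∧ β = 0)
    ?_ ?_ δ β 0 hδ ⟨hd, rfl⟩).1
  · rintro d e α β he ⟨h1, hβ⟩
    refine ⟨?_, (mul_eq_zero.mp hβ).resolve_left he⟩
    rw [← mul_dvd_mul_iff_left (pow_ne_zero 2 he)]
    convert h1 using 1 <;> ring
  · rintro x₀ d α _ ⟨h1, rfl⟩
    obtain ⟨p1, p1'⟩ := eval_eq_zero_of_sq_dvd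
      ((Dvd.intro _ (mul_pow (X - C x₀) d 2).symm).trans h1)
    simp only [derivative_mul, derivative_pow, eval_add, eval_mul, eval_pow] at p1 p1'
    rw [dvd_iff_isRoot, IsRoot]
    refine ⟨?_, dvd_zero _⟩
    by_contra hα
    have hG : G.eval x₀ = 0 := by simpa [hα] using p1
    simp [hG, hα, h.simple_root x₀ hG] at p1'

/-- The two dividends are the coefficients of 1 and w in (α + βw)²(a + bw). If α + βw is nonzero at
a point over a root x₀ of δ, then a + bw has to vanish doubly there, against smoothness. So α + βw
vanishes at both points over x₀. -/
theorem IsSmoothTower.dvd_of_sq_dvd [IsAlgClosed k] [CharZero k] {G a b : k[X]}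
    (h : IsSmoothTower G a b) {δ α β : k[X]} (hδ : δ ≠ 0)
    (h1 : δ ^ 2 ∣ (α ^ 2 + β ^ 2 * G) * a + 2 * α * β * G * b)
    (h2 : δ ^ 2 ∣ (α ^ 2 + β ^ 2 * G) * b + 2 * α * β * a) : δ ∣ α ∧ δ ∣ β := by
  refine dvd_and_dvd_of_forall_root
    (Q := fun δ α β => δ ^ 2 ∣ (α ^ 2 + β ^ 2 * G) * a + 2 * α * β * G * b ∧
      δ ^ 2 ∣ (α ^ 2 + β ^ 2 * G) * b + 2 * α * β * a) ?_ ?_ δ α β hδ ⟨h1, h2⟩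
  · rintro d e α β he ⟨h1, h2⟩
    have he2 : e ^ 2 ≠ 0 := pow_ne_zero 2 he
    constructor
    · rw [← mul_dvd_mul_iff_left he2]
      convert h1 using 1 <;> ring
    · rw [← mul_dvd_mul_iff_left he2]
      convert h2 using 1 <;> ring
  · rintro x₀ d α β ⟨h1, h2⟩
    obtain ⟨p1, p1'⟩ := eval_eq_zero_of_sq_dvd
      ((Dvd.intro _ (mul_pow (X - C x₀) d 2).symm).trans h1)
    obtain ⟨p2, p2'⟩ := eval_eq_zero_of_sq_dvd
      ((Dvd.intro _ (mul_pow (X - C x₀) d 2).symm).trans h2)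
    simp only [derivative_mul, derivative_add, derivative_pow, eval_add, eval_mul, eval_pow,
      derivative_ofNat, eval_ofNat, eval_zero, Nat.cast_ofNat, map_ofNat] at p1 p1' p2 p2'
    have key : ∀ w₀, w₀ ^ 2 = G.eval x₀ → α.eval x₀ + β.eval x₀ * w₀ = 0 := by
      intro w₀ hw
      by_contra he
      have hE : a.eval x₀ + b.eval x₀ * w₀ = 0 := by
        have : (α.eval x₀ + β.eval x₀ * w₀) ^ 2 * (a.eval x₀ + b.eval x₀ * w₀) = 0 := by
          grind
        simpa [he] using this
      apply h.simple_zero x₀ w₀ hw hE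
      apply (mul_eq_zero_iff_left (pow_ne_zero 2 he)).mp
      -- The derivative is taken along w² = G and multiplied by 2w, which clears the denominator of
      -- w' = G'/(2w).
      rw [← hw] at p1' p2' p2 ⊢
      linear_combination 2 * w₀ * p1' + 2 * w₀ ^ 2 * p2' + G.derivative.eval x₀ * p2
        - 2 * (α.eval x₀ + β.eval x₀ * w₀) * (2 * w₀ * α.derivative.eval x₀
          + 2 * w₀ ^ 2 * β.derivative.eval x₀ + β.eval x₀ * G.derivative.eval x₀) * hE
    obtain ⟨w₀, hw⟩ := IsAlgClosed.exists_pow_nat_eq (G.eval x₀) two_pos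
    rw [dvd_iff_isRoot, dvd_iff_isRoot, IsRoot, IsRoot]
    have k1 := key w₀ hw
    have k2 := key (-w₀) (by rw [neg_sq, hw])
    -- At a branch point the two points over x₀ coincide and only α is seen to vanish; β is handled
    -- through the simple root of G.
    by_cases hw0 : w₀ = 0
    · subst hw0
      have hG : G.eval x₀ = 0 := by simpa using hw.symm
      have hα : α.eval x₀ = 0 := by simpa using k1
      refine ⟨hα, ?_⟩
      by_contra hβ
      have hG' := h.simple_root x₀ hG
      simp only [hα, hG] at p1' p2'
      have ha : a.eval x₀ = 0 := by
        have : β.eval x₀ ^ 2 * G.derivative.eval x₀ * a.eval x₀ = 0 := by linear_combination p1'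
        simpa [hβ, hG'] using this
      have hb : b.eval x₀ = 0 := by
        have : β.eval x₀ ^ 2 * G.derivative.eval x₀ * b.eval x₀ = 0 := by
          rw [ha] at p2'
          linear_combination p2'
        simpa [hβ, hG'] using this
      exact h.simple_zero x₀ 0 (by simp [hG]) (by simp [ha, hb]) (by simp [hG, hb])
    · have hα : α.eval x₀ = 0 := by
        have : 2 * α.eval x₀ = 0 := by linear_combination k1 + k2
        simpa using this
      refine ⟨hα, ?_⟩
      simpa [hα, hw0] using k1

end Tower

/-! ### Linear independence of 1, w, u, wu over the base field. -/

section QuadraticTower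

variable {K L : Type*} [Field K] [Field L] [Algebra K L]

theorem eq_zero_of_add_mul_eq_zero {w : L} {G : K} (hw : w ^ 2 = algebraMap K L G)
    (hG : ∀ c, c ^ 2 ≠ G) {α β : K} (h : algebraMap K L α + algebraMap K L β * w = 0) :
    α = 0 ∧ β = 0 := by
  by_cases hβ : β = 0
  · subst hβ
    exact ⟨by simpa using h, rfl⟩
  · exfalso
    apply hG (α / β)
    apply (algebraMap K L).injective
    have hb : algebraMap K L β ≠ 0 := by simpa using hβ
    rw [← hw, map_pow, map_div₀, div_pow, div_eq_iff (pow_ne_zero 2 hb)]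
    linear_combination (algebraMap K L α - algebraMap K L β * w) * h

/-- A relation that involves u can be solved for u after multiplying by the conjugate γ - δw. Then u
lies in K + Kw and a + bw is a square there, which `hab` excludes. -/
theorem eq_zero_of_tower_combination_eq_zero {w u : L} {G a b : K}
    (hw : w ^ 2 = algebraMap K L G) (hu : u ^ 2 = algebraMap K L a + algebraMap K L b * w)
    (hG : ∀ c, c ^ 2 ≠ G) (hab : ∀ α β, α ^ 2 + β ^ 2 * G = a → 2 * α * β = b → False)
    {α β γ δ : K} (h : algebraMap K L α + algebraMap K L β * w
      + (algebraMap K L γ + algebraMap K L δ * w) * u = 0) :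
    α = 0 ∧ β = 0 ∧ γ = 0 ∧ δ = 0 := by
  by_cases hz : algebraMap K L γ + algebraMap K L δ * w = 0
  · rw [hz, zero_mul, add_zero] at h
    obtain ⟨h1, h2⟩ := eq_zero_of_add_mul_eq_zero hw hG hz
    obtain ⟨h3, h4⟩ := eq_zero_of_add_mul_eq_zero hw hG h
    exact ⟨h3, h4, h1, h2⟩
  · exfalso
    have hn : γ ^ 2 - δ ^ 2 * G ≠ 0 := by
      intro h0
      by_cases hδ : δ = 0
      · simp [hδ] at h0; simp [hδ, h0] at hz
      · exact hG (γ / δ) (by rw [div_pow, div_eq_iff (pow_ne_zero 2 hδ)]; linear_combination h0)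
    set n := γ ^ 2 - δ ^ 2 * G with hn_def
    have hnL : algebraMap K L n ≠ 0 := by simpa using hn
    have hnw : algebraMap K L n
        = (algebraMap K L γ + algebraMap K L δ * w) * (algebraMap K L γ - algebraMap K L δ * w) := by
      rw [hn_def, map_sub, map_mul, map_pow, map_pow, ← hw]; ring
    have hu' : u = algebraMap K L (-(α * γ - β * δ * G) / n)
        + algebraMap K L (-(β * γ - α * δ) / n) * w := by
      rw [map_div₀, map_div₀, div_mul_eq_mul_div, ← add_div, eq_div_iff hnL, hnw]
      simp only [map_neg, map_sub, map_mul, ← hw]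
      linear_combination (algebraMap K L γ - algebraMap K L δ * w) * h
    set c := -(α * γ - β * δ * G) / n
    set d := -(β * γ - α * δ) / n
    have : algebraMap K L (c ^ 2 + d ^ 2 * G - a) + algebraMap K L (2 * c * d - b) * w = 0 := by
      simp only [map_sub, map_add, map_mul, map_pow, map_ofNat, ← hw]
      rw [hu'] at hu
      linear_combination hu
    obtain ⟨h1, h2⟩ := eq_zero_of_add_mul_eq_zero hw hG this
    exact hab c d (sub_eq_zero.mp h1) (sub_eq_zero.mp h2)

end QuadraticTower

/-! ### The integral closure of k[x] in the tower. -/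

section Integral

variable {k K L : Type*} [Field k] [Field K] [Field L] [Algebra k[X] K]
  [IsFractionRing k[X] K] [Algebra K L] [Algebra k[X] L] [IsScalarTower k[X] K L]

theorem sq_ne_algebraMap [IsAlgClosed k] {G : k[X]}
    (hG : ∀ x₀, G.eval x₀ = 0 → G.derivative.eval x₀ ≠ 0)
    (hdeg : ∃ x₀, G.eval x₀ = 0) (c : K) : c ^ 2 ≠ algebraMap k[X] K G := by
  intro h
  have hint : IsIntegral k[X] c :=
    IsIntegral.of_pow two_pos (h ▸ isIntegral_algebraMap)
  obtain ⟨e, rfl⟩ := IsIntegrallyClosed.isIntegral_iff.mp hint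
  rw [← map_pow] at h
  have h' := IsFractionRing.injective k[X] K h
  obtain ⟨x₀, hx⟩ := hdeg
  apply hG x₀ hx
  rw [← h'] at hx ⊢
  simp only [eval_pow, derivative_pow] at hx ⊢
  simp [pow_eq_zero_iff two_ne_zero |>.mp hx]

/-- For β ≠ 0 the minimal polynomial is X² - 2αX + (α² - β²G), and its coefficients lie in k[x]
because k[x] is integrally closed. Thus α and β²G are polynomials, and the simple roots of G leave
no denominator in β. -/
theorem coeff_integral_of_isIntegral [IsAlgClosed k] [CharZero k] {G a b : k[X]}
    (hs : IsSmoothTower G a b) (hdeg : ∃ x₀, G.eval x₀ = 0) {w : L}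
    (hw : w ^ 2 = algebraMap k[X] L G) {α β : K}
    (h : IsIntegral k[X] (algebraMap K L α + algebraMap K L β * w)) :
    (∃ p, algebraMap k[X] K p = α) ∧ ∃ p, algebraMap k[X] K p = β := by
  have hG := sq_ne_algebraMap (K := K) hs.simple_root hdeg
  have hw' : w ^ 2 = algebraMap K L (algebraMap k[X] K G) := by
    rw [hw, ← IsScalarTower.algebraMap_apply]
  by_cases hβ : β = 0
  · subst hβ
    refine ⟨IsIntegrallyClosed.isIntegral_iff.mp ?_, 0, by simp⟩
    simpa [isIntegral_algebraMap_iff (algebraMap K L).injective] using h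
  set e := algebraMap K L α + algebraMap K L β * w with he
  set q : K[X] := X ^ 2 - C (2 * α) * X + C (α ^ 2 - β ^ 2 * algebraMap k[X] K G) with hq
  have hqm : q.Monic := by rw [hq]; monicity!
  have hqd : q.natDegree ≤ 2 := by rw [hq]; compute_degree
  have hqe : aeval e q = 0 := by
    simp only [hq, map_add, map_sub, map_mul, map_pow, aeval_X, aeval_C, ← hw', he, map_ofNat]
    ring
  have hK : IsIntegral K e := h.tower_top
  have h2 : 2 ≤ (minpoly K e).natDegree := by
    rw [minpoly.two_le_natDegree_iff hK]
    rintro ⟨c, hc⟩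
    refine hβ (eq_zero_of_add_mul_eq_zero hw' hG (α := α - c) ?_).2
    rw [map_sub, hc, he]; ring
  have hmin : q = minpoly K e := eq_of_monic_of_dvd_of_natDegree_le (minpoly.monic hK) hqm
    (minpoly.dvd K e hqe) (hqd.trans h2)
  rw [minpoly.isIntegrallyClosed_eq_field_fractions' K h] at hmin
  have c1 : algebraMap k[X] K ((minpoly k[X] e).coeff 1) = -(2 * α) := by
    rw [← coeff_map, ← hmin, hq]
    simp only [coeff_add, coeff_sub, coeff_X_pow, coeff_C_mul, coeff_X, coeff_C]; norm_num
  have c0 : algebraMap k[X] K ((minpoly k[X] e).coeff 0) = α ^ 2 - β ^ 2 * algebraMap k[X] K G := by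
    rw [← coeff_map, ← hmin, hq]
    simp only [coeff_add, coeff_sub, coeff_X_pow, coeff_C_mul, coeff_X, coeff_C]; norm_num
  have hα : ∃ p, algebraMap k[X] K p = α := by
    refine ⟨- C (1 / 2) * (minpoly k[X] e).coeff 1, ?_⟩
    rw [map_mul, c1, map_neg]
    have : algebraMap k[X] K (C (1 / 2)) * 2 = 1 := by
      rw [← map_ofNat (algebraMap k[X] K) 2, ← map_mul, ← map_one (algebraMap k[X] K)]
      congr 1
      rw [← map_ofNat C 2, ← C_mul]; simp
    linear_combination α * this
  refine ⟨hα, ?_⟩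
  obtain ⟨p, rfl⟩ := hα
  obtain ⟨n, d, hd, rfl⟩ := IsFractionRing.div_surjective (A := k[X]) β
  have hd0 : d ≠ 0 := nonZeroDivisors.ne_zero hd
  have hdK : algebraMap k[X] K d ≠ 0 := by
    simpa using hd0
  have hdvd : d ^ 2 ∣ n ^ 2 * G := by
    refine ⟨p ^ 2 - (minpoly k[X] e).coeff 0, IsFractionRing.injective k[X] K ?_⟩
    simp only [map_mul, map_sub, map_pow, c0]
    field_simp
    ring
  obtain ⟨m, rfl⟩ := hs.dvd_of_sq_dvd_sq_mul hd0 hdvd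
  exact ⟨m, by rw [map_mul]; field_simp⟩

/-- A square root of a + bw would be integral, hence of the form p + qw with polynomials p, q. Then
a + bw would have a double zero at the point supplied by `hpt`. -/
theorem tower_ne_sq [IsAlgClosed k] [CharZero k] {G a b : k[X]} (hs : IsSmoothTower G a b)
    (hdeg : ∃ x₀, G.eval x₀ = 0) {w : L} (hw : w ^ 2 = algebraMap k[X] L G)
    (hpt : ∃ x₀ w₀, w₀ ^ 2 = G.eval x₀ ∧ a.eval x₀ + b.eval x₀ * w₀ = 0) (α β : K)
    (h1 : α ^ 2 + β ^ 2 * algebraMap k[X] K G = algebraMap k[X] K a)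
    (h2 : 2 * α * β = algebraMap k[X] K b) : False := by
  have hint : IsIntegral k[X] (algebraMap K L α + algebraMap K L β * w) := by
    refine IsIntegral.of_pow two_pos ?_
    have : (algebraMap K L α + algebraMap K L β * w) ^ 2
        = algebraMap k[X] L a + algebraMap k[X] L b * w := by
      rw [IsScalarTower.algebraMap_apply k[X] K L a, IsScalarTower.algebraMap_apply k[X] K L b,
        ← h1, ← h2]
      simp only [map_add, map_mul, map_pow, map_ofNat, ← IsScalarTower.algebraMap_apply k[X] K L,
        ← hw]
      ring
    rw [this]
    refine isIntegral_algebraMap.add (isIntegral_algebraMap.mul (IsIntegral.of_pow two_pos ?_))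
    rw [hw]; exact isIntegral_algebraMap
  obtain ⟨⟨p, rfl⟩, q, rfl⟩ := coeff_integral_of_isIntegral hs hdeg hw hint
  have e1 : p ^ 2 + q ^ 2 * G = a := IsFractionRing.injective k[X] K (by simpa using h1)
  have e2 : 2 * p * q = b := IsFractionRing.injective k[X] K (by
    rw [map_mul, map_mul, map_ofNat]; exact h2)
  obtain ⟨x₀, w₀, hw₀, h0⟩ := hpt
  apply hs.simple_zero x₀ w₀ hw₀ h0
  rw [← e1, ← e2] at h0 ⊢
  simp only [derivative_mul, derivative_add, derivative_pow, eval_add, eval_mul, eval_pow,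
    derivative_ofNat, eval_ofNat, eval_zero, Nat.cast_ofNat, map_ofNat, ← hw₀] at h0 ⊢
  have h00 : p.eval x₀ + q.eval x₀ * w₀ = 0 := by
    rw [← pow_eq_zero_iff two_ne_zero, ← h0]; ring
  linear_combination 2 * (2 * w₀ * p.derivative.eval x₀
    + 2 * w₀ ^ 2 * q.derivative.eval x₀ + q.eval x₀ * G.derivative.eval x₀) * h00

/-- The involution σ splits an integral element into its even and odd parts in u, both integral. The
even part is settled by `coeff_integral_of_isIntegral`; the odd part is squared so as to land in K +
Kw, where `IsSmoothTower.dvd_of_sq_dvd` clears the denominators. -/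
theorem isIntegral_tower_iff [IsAlgClosed k] [CharZero k] {G a b : k[X]} (hs : IsSmoothTower G a b)
    (hdeg : ∃ x₀, G.eval x₀ = 0) {w u : L} (hw : w ^ 2 = algebraMap k[X] L G)
    (hu : u ^ 2 = algebraMap k[X] L a + algebraMap k[X] L b * w)
    (σ : L →ₐ[K] L) (σw : σ w = w) (σu : σ u = -u) (α β γ δ : K) :
    IsIntegral k[X] (algebraMap K L α + algebraMap K L β * w
      + (algebraMap K L γ + algebraMap K L δ * w) * u) ↔
    (α ∈ (algebraMap k[X] K).range ∧ β ∈ (algebraMap k[X] K).range ∧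
      γ ∈ (algebraMap k[X] K).range ∧ δ ∈ (algebraMap k[X] K).range) := by
  have iw : IsIntegral k[X] w := IsIntegral.of_pow two_pos (hw ▸ isIntegral_algebraMap)
  have iu : IsIntegral k[X] u := IsIntegral.of_pow two_pos
    (hu ▸ isIntegral_algebraMap.add (isIntegral_algebraMap.mul iw))
  constructor
  · intro h
    have hσ := h.map (σ.restrictScalars k[X])
    simp only [AlgHom.coe_restrictScalars', map_add, map_mul, AlgHom.commutes, σw, σu] at hσ
    have ihalf : IsIntegral k[X] (algebraMap k[X] L (C (1 / 2))) := isIntegral_algebraMap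
    have hhalf : algebraMap k[X] L (C (1 / 2)) * 2 = 1 := by
      rw [← map_ofNat (algebraMap k[X] L) 2, ← map_mul, ← map_one (algebraMap k[X] L)]
      congr 1
      rw [← map_ofNat C 2, ← C_mul]; simp
    have h1 : IsIntegral k[X] (algebraMap K L α + algebraMap K L β * w) := by
      have e : algebraMap K L α + algebraMap K L β * w = algebraMap k[X] L (C (1 / 2))
          * ((algebraMap K L α + algebraMap K L β * w
            + (algebraMap K L γ + algebraMap K L δ * w) * u)
          + (algebraMap K L α + algebraMap K L β * w
            + (algebraMap K L γ + algebraMap K L δ * w) * -u)) := by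
        linear_combination -(algebraMap K L α + algebraMap K L β * w) * hhalf
      rw [e]
      exact ihalf.mul (h.add hσ)
    have h2 : IsIntegral k[X] ((algebraMap K L γ + algebraMap K L δ * w) * u) := by
      have e : (algebraMap K L γ + algebraMap K L δ * w) * u = algebraMap k[X] L (C (1 / 2))
          * ((algebraMap K L α + algebraMap K L β * w
            + (algebraMap K L γ + algebraMap K L δ * w) * u)
          - (algebraMap K L α + algebraMap K L β * w
            + (algebraMap K L γ + algebraMap K L δ * w) * -u)) := by
        linear_combination -((algebraMap K L γ + algebraMap K L δ * w) * u) * hhalf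
      rw [e]
      exact ihalf.mul (h.sub hσ)
    obtain ⟨hα, hβ⟩ := coeff_integral_of_isIntegral hs hdeg hw h1
    refine ⟨hα, hβ, ?_⟩
    have h3 : IsIntegral k[X] (algebraMap K L ((γ ^ 2 + δ ^ 2 * algebraMap k[X] K G)
        * algebraMap k[X] K a + 2 * γ * δ * algebraMap k[X] K G * algebraMap k[X] K b)
        + algebraMap K L ((γ ^ 2 + δ ^ 2 * algebraMap k[X] K G) * algebraMap k[X] K b
        + 2 * γ * δ * algebraMap k[X] K a) * w) := by
      convert h2.pow 2 using 1
      rw [mul_pow, hu]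
      simp only [map_add, map_mul, map_pow, map_ofNat, ← IsScalarTower.algebraMap_apply k[X] K L,
        ← hw]
      ring
    obtain ⟨⟨p1, hp1⟩, p2, hp2⟩ := coeff_integral_of_isIntegral hs hdeg hw h3
    obtain ⟨n1, d1, hd1, rfl⟩ := IsFractionRing.div_surjective (A := k[X]) γ
    obtain ⟨n2, d2, hd2, rfl⟩ := IsFractionRing.div_surjective (A := k[X]) δ
    replace hd1 := nonZeroDivisors.ne_zero hd1
    replace hd2 := nonZeroDivisors.ne_zero hd2
    have hd1K : algebraMap k[X] K d1 ≠ 0 := by simpa using hd1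
    have hd2K : algebraMap k[X] K d2 ≠ 0 := by simpa using hd2
    -- The common denominator is d1 * d2.
    obtain ⟨⟨q1, hq1⟩, q2, hq2⟩ := hs.dvd_of_sq_dvd (α := n1 * d2) (β := n2 * d1)
      (mul_ne_zero hd1 hd2)
      ⟨p1, IsFractionRing.injective k[X] K (by
        simp only [map_mul, map_add, map_pow, hp1, map_ofNat]
        field_simp)⟩
      ⟨p2, IsFractionRing.injective k[X] K (by
        simp only [map_mul, map_add, map_pow, hp2, map_ofNat]
        field_simp)⟩
    have hn1 : n1 = d1 * q1 := mul_right_cancel₀ hd2 (by rw [hq1]; ring)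
    have hn2 : n2 = d2 * q2 := mul_right_cancel₀ hd1 (by rw [hq2]; ring)
    exact ⟨⟨q1, by rw [hn1, map_mul]; field_simp⟩, ⟨q2, by rw [hn2, map_mul]; field_simp⟩⟩
  · rintro ⟨⟨p1, rfl⟩, ⟨p2, rfl⟩, ⟨p3, rfl⟩, ⟨p4, rfl⟩⟩
    simp only [← IsScalarTower.algebraMap_apply k[X] K L]
    exact (isIntegral_algebraMap.add (isIntegral_algebraMap.mul iw)).add
      ((isIntegral_algebraMap.add (isIntegral_algebraMap.mul iw)).mul iu)

end Integral

/-! ### Geometry of the cubic P + Q + R = φ, PQR = ξ, and smoothness of both charts. -/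

section Smoothness

variable {k : Type*} [Field k]

/-- The parameter `φ` is a root of `φ² = φ + 1`, and `ξ` is none of the three values for which the
curve degenerates. -/
structure IsNondegenerate (φ ξ : k) : Prop where
  golden : φ ^ 2 = φ + 1
  ne_zero : ξ ≠ 0
  ne_max : 27 * ξ ≠ φ ^ 3
  ne_min : 5 * ξ ≠ -φ ^ 3

theorem IsNondegenerate.of_map {k' : Type*} [Field k'] (i : k →+* k') {φ ξ : k}
    (h : IsNondegenerate (i φ) (i ξ)) : IsNondegenerate φ ξ := by
  obtain ⟨h1, h2, h3, h4⟩ := h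
  refine ⟨i.injective (by simpa using h1), fun h => h2 (by simp [h]), fun h => h3 ?_,
    fun h => h4 ?_⟩
  · simpa [map_ofNat] using congrArg i h
  · simpa [map_ofNat] using congrArg i h

theorem IsNondegenerate.map_ringHom {k' : Type*} [Field k'] (i : k →+* k') {φ ξ : k}
    (h : IsNondegenerate φ ξ) : IsNondegenerate (i φ) (i ξ) := by
  constructor
  · rw [← map_pow, h.golden, map_add, map_one]
  · simpa using h.ne_zero
  · rw [← map_pow, ← map_ofNat i, ← map_mul]
    exact i.injective.ne h.ne_max
  · rw [← map_pow, ← map_ofNat i, ← map_mul, ← map_neg]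
    exact i.injective.ne h.ne_min

theorem golden_ne_zero {φ : k} (hφ : φ ^ 2 = φ + 1) : φ ≠ 0 := by
  rintro rfl; simp at hφ

theorem golden_sqrt_ne_zero [CharZero k] {φ : k} (hφ : φ ^ 2 = φ + 1) : 2 * φ - 1 ≠ 0 := by
  intro h
  have : (5 : k) = 0 := by linear_combination (2 * φ - 1) * h - 4 * hφ
  norm_num at this

theorem golden_pow_six_ne_one [CharZero k] {φ : k} (hφ : φ ^ 2 = φ + 1) : φ ^ 6 - 1 ≠ 0 := by
  have h : φ ^ 6 - 1 = 4 * φ ^ 3 := by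
    linear_combination (φ ^ 4 + φ ^ 3 + 2 * φ ^ 2 - φ + 1) * hφ
  rw [h]
  exact mul_ne_zero (by norm_num) (pow_ne_zero 3 (golden_ne_zero hφ))

/-- The product of the three linear forms that are proportional to `p²`, `q²`, `r²`. -/
theorem elliptic_norm_identity {φ P Q R ξ : k} (hφ : φ ^ 2 = φ + 1)
    (hs : P + Q + R = φ) (hp : P * Q * R = ξ) :
    φ ^ 6 * ((2 * φ - 1) * (2 * P ^ 3 - φ * P ^ 2 + ξ) * (Q - R)
      - (7 * φ * P ^ 3 - 7 * φ ^ 2 * P ^ 2 - (11 * ξ + 2 * φ ^ 3) * P - 7 * ξ * φ))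
    = 2 * P * ((φ ^ 4 * P + φ ^ 2 * Q + R) * (φ ^ 4 * Q + φ ^ 2 * R + P)
      * (φ ^ 4 * R + φ ^ 2 * P + Q)) := by
  obtain rfl : R = φ - P - Q := by rw [← hs]; ring
  subst hp
  clear hs
  grind

/-- The derivative of `elliptic_norm_identity` along the invariant vector field. -/
theorem elliptic_norm_deriv_identity {φ P Q R ξ : k} (hφ : φ ^ 2 = φ + 1) (hs : P + Q + R = φ)
    (hp : P * Q * R = ξ) :
    φ ^ 6 * (-2 * (28 * φ * P ^ 3 - 21 * φ ^ 2 * P ^ 2 - 2 * (11 * ξ + 2 * φ ^ 3) * P - 7 * ξ * φ)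
        * (P * (Q - R))
      + 2 * (P ^ 4 - 2 * φ * P ^ 3 + φ ^ 2 * P ^ 2 - 4 * ξ * P)
        * ((2 * φ - 1) * (6 * P ^ 2 - 2 * φ * P))
      + (2 * φ - 1) * (2 * P ^ 3 - φ * P ^ 2 + ξ)
        * (4 * P ^ 3 - 6 * φ * P ^ 2 + 2 * φ ^ 2 * P - 4 * ξ))
    = 4 * P ^ 2 * (2 * (Q - R) * ((φ ^ 4 * P + φ ^ 2 * Q + R) * (φ ^ 4 * Q + φ ^ 2 * R + P)
        * (φ ^ 4 * R + φ ^ 2 * P + Q))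
      + ((φ ^ 4 * P * (Q - R) + φ ^ 2 * Q * (R - P) + R * (P - Q))
          * ((φ ^ 4 * Q + φ ^ 2 * R + P) * (φ ^ 4 * R + φ ^ 2 * P + Q))
        + (φ ^ 4 * Q * (R - P) + φ ^ 2 * R * (P - Q) + P * (Q - R))
          * ((φ ^ 4 * R + φ ^ 2 * P + Q) * (φ ^ 4 * P + φ ^ 2 * Q + R))
        + (φ ^ 4 * R * (P - Q) + φ ^ 2 * P * (Q - R) + Q * (R - P))
          * ((φ ^ 4 * P + φ ^ 2 * Q + R) * (φ ^ 4 * Q + φ ^ 2 * R + P)))) := by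
  obtain rfl : R = φ - P - Q := by rw [← hs]; ring
  subst hp
  clear hs
  grind

/-- The line `φ⁴P + φ²Q + R = 0` is not tangent to the cubic curve `P + Q + R = φ`, `PQR = ξ`. -/
theorem IsNondegenerate.not_tangent {φ ξ P Q R : k} (h : IsNondegenerate φ ξ)
    (hs : P + Q + R = φ) (hp : P * Q * R = ξ) (hl : φ ^ 4 * P + φ ^ 2 * Q + R = 0)
    (ht : φ ^ 4 * P * (Q - R) + φ ^ 2 * Q * (R - P) + R * (P - Q) = 0) : False := by
  obtain ⟨hφ, -, h3, h5⟩ := h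
  have f3 : φ ^ 3 = 2 * φ + 1 := by linear_combination (φ + 1) * hφ
  have f4 : φ ^ 4 = 3 * φ + 2 := by linear_combination (φ ^ 2 + φ + 2) * hφ
  have hφ0 : φ ≠ 0 := golden_ne_zero hφ
  -- After eliminating R by the equation of the line, the tangency condition is a binary quadratic
  -- form in P and Q. Its two roots lead to the excluded values 27ξ = φ³ and 5ξ = -φ³ respectively.
  have key : (Q - φ ^ 3 * P) * (Q - (1 - 2 * φ) * P) = 0 := by
    obtain rfl : R = -φ ^ 4 * P - φ ^ 2 * Q := by linear_combination hl
    have : φ ^ 3 * ((Q - φ ^ 3 * P) * (Q - (1 - 2 * φ) * P)) = 0 := by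
      clear hs hp hl h3 h5
      grind
    simpa [hφ0] using this
  rcases mul_eq_zero.mp key with h | h
  · obtain rfl : Q = φ ^ 3 * P := by linear_combination h
    obtain rfl : R = -φ ^ 6 * P := by clear hs hp h3 h5; grind
    have : -3 * φ ^ 2 * P = 1 := by
      have : φ * (-3 * φ ^ 2 * P - 1) = 0 := by clear hl ht h; grind
      simpa [hφ0, sub_eq_zero] using this
    apply h3
    rw [← hp]
    linear_combination φ ^ 3 * (1 + (-3 * φ ^ 2 * P) + (-3 * φ ^ 2 * P) ^ 2) * this
  · obtain rfl : Q = (1 - 2 * φ) * P := by linear_combination h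
    obtain rfl : R = - P := by clear hs hp h3 h5; grind
    have h5' : (1 - 2 * φ) ^ 2 = 5 := by linear_combination 4 * hφ
    apply h5
    rw [← hp]
    linear_combination -(((1 - 2 * φ) * P) ^ 2 + (1 - 2 * φ) * P * φ + φ ^ 2) * hs
      + (1 - 2 * φ) * P ^ 3 * h5'

/-- The three linear forms have at most simple zeros on the cubic curve, and no common zeros. -/
theorem IsNondegenerate.not_double_zero_of_eq_zero [CharZero k] {φ ξ P Q R : k}
    (h : IsNondegenerate φ ξ)
    (hs : P + Q + R = φ) (hp : P * Q * R = ξ) (hl : φ ^ 4 * P + φ ^ 2 * Q + R = 0)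
    (ht : (φ ^ 4 * P * (Q - R) + φ ^ 2 * Q * (R - P) + R * (P - Q))
      * ((φ ^ 4 * Q + φ ^ 2 * R + P) * (φ ^ 4 * R + φ ^ 2 * P + Q)) = 0) : False := by
  have h6 := golden_pow_six_ne_one h.golden
  rcases mul_eq_zero.mp ht with h1 | h1
  · exact h.not_tangent hs hp hl h1
  rcases mul_eq_zero.mp h1 with h2 | h2
  · have hP : (φ ^ 6 - 1) * P = 0 := by linear_combination φ ^ 2 * hl - h2
    exact h.ne_zero (by rw [← hp, (mul_eq_zero.mp hP).resolve_left h6]; ring)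
  · have hR : (φ ^ 6 - 1) * R = 0 := by linear_combination φ ^ 2 * h2 - hl
    exact h.ne_zero (by rw [← hp, (mul_eq_zero.mp hR).resolve_left h6]; ring)

/-- A point `(x, w)` of the curve `w² = x g(x)` with `x ≠ 0` is not a double zero of
`√5 h(x) w - x f(x)`. -/
theorem IsNondegenerate.not_double_zero [CharZero k] {φ ξ x w : k} (h : IsNondegenerate φ ξ)
    (hx : x ≠ 0) (hw : w ^ 2 = x ^ 4 - 2 * φ * x ^ 3 + φ ^ 2 * x ^ 2 - 4 * ξ * x)
    (h0 : (2 * φ - 1) * (2 * x ^ 3 - φ * x ^ 2 + ξ) * w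
      - x * (7 * φ * x ^ 3 - 7 * φ ^ 2 * x ^ 2 - (11 * ξ + 2 * φ ^ 3) * x - 7 * ξ * φ) = 0)
    (h1 : -2 * (28 * φ * x ^ 3 - 21 * φ ^ 2 * x ^ 2 - 2 * (11 * ξ + 2 * φ ^ 3) * x - 7 * ξ * φ) * w
      + 2 * (x ^ 4 - 2 * φ * x ^ 3 + φ ^ 2 * x ^ 2 - 4 * ξ * x)
        * ((2 * φ - 1) * (6 * x ^ 2 - 2 * φ * x))
      + (2 * φ - 1) * (2 * x ^ 3 - φ * x ^ 2 + ξ)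
        * (4 * x ^ 3 - 6 * φ * x ^ 2 + 2 * φ ^ 2 * x - 4 * ξ) = 0) : False := by
  -- A point (x, w) with x ≠ 0 comes from the point (x, Q, R) of the cubic determined by Q + R = φ -
  -- x and x(Q - R) = w.
  obtain ⟨z, rfl⟩ : ∃ z, w = x * z := ⟨w / x, by field_simp⟩
  obtain ⟨Q, hQ⟩ : ∃ Q, Q = (φ - x + z) / 2 := ⟨_, rfl⟩
  obtain ⟨R, hR⟩ : ∃ R, R = (φ - x - z) / 2 := ⟨_, rfl⟩
  have hz : z = Q - R := by rw [hQ, hR]; ring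
  have hs : x + Q + R = φ := by rw [hQ, hR]; ring
  have hp : x * Q * R = ξ := by
    have : 4 * x * (x * Q * R - ξ) = 0 := by rw [hQ, hR]; linear_combination -hw
    simpa [hx, sub_eq_zero] using this
  rw [hz] at h0 h1
  have i0 := elliptic_norm_identity h.golden hs hp
  have i1 := elliptic_norm_deriv_identity h.golden hs hp
  rw [h1, mul_zero] at i1
  replace i0 : (φ ^ 4 * x + φ ^ 2 * Q + R) * (φ ^ 4 * Q + φ ^ 2 * R + x)
      * (φ ^ 4 * R + φ ^ 2 * x + Q) = 0 := by
    have : 2 * x ^ 2 * ((φ ^ 4 * x + φ ^ 2 * Q + R) * (φ ^ 4 * Q + φ ^ 2 * R + x)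
        * (φ ^ 4 * R + φ ^ 2 * x + Q)) = 0 := by
      linear_combination φ ^ 6 * h0 - x * i0
    simpa only [mul_eq_zero, pow_eq_zero_iff two_ne_zero, two_ne_zero, hx, false_or] using this
  rw [i0, mul_zero, zero_add, eq_comm] at i1
  replace i1 := (mul_eq_zero.mp i1).resolve_left (mul_ne_zero (by norm_num) (pow_ne_zero 2 hx))
  rcases mul_eq_zero.mp i0 with h2 | h2
  · rcases mul_eq_zero.mp h2 with h3 | h3
    · rw [h3] at i1
      exact h.not_double_zero_of_eq_zero hs hp h3 (by linear_combination i1)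
    · rw [h3] at i1
      exact h.not_double_zero_of_eq_zero (P := Q) (Q := R) (R := x) (by rw [← hs]; ring)
        (by rw [← hp]; ring) h3 (by linear_combination i1)
  · rw [h2] at i1
    exact h.not_double_zero_of_eq_zero (P := R) (Q := x) (R := Q) (by rw [← hs]; ring)
      (by rw [← hp]; ring) h2 (by linear_combination i1)

/-- A double root of x g forces ξ = 0 or 27ξ = φ³. Zeros of u² with x ≠ 0 are simple by
`IsNondegenerate.not_double_zero`; at x = w = 0 what counts is that h(0) = ξ and the derivative of x
g at 0 are nonzero. -/
theorem IsNondegenerate.isSmoothTower [CharZero k] {φ ξ c : k} (h : IsNondegenerate φ ξ)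
    (hc : c ≠ 0) :
    IsSmoothTower (X * gPoly φ ξ) (-C c * X * fPoly φ ξ) (C (c * (2 * φ - 1)) * hPoly φ ξ) := by
  have h5 := golden_sqrt_ne_zero h.golden
  have hξ := h.ne_zero
  constructor
  · intro x hx hx'
    simp [gPoly, derivative_pow] at hx hx'
    rcases hx with rfl | hx
    · simp at hx'; exact hξ hx'
    · by_cases hx0 : x = 0
      · subst hx0; simp at hx; exact hξ hx
      have h2 : (x - φ) * (3 * x - φ) = 0 := by
        have : x * ((x - φ) * (3 * x - φ)) = 0 := by linear_combination hx' - hx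
        simpa [hx0] using this
      rcases mul_eq_zero.mp h2 with h3 | h3
      · apply hξ
        have : 4 * ξ = 0 := by linear_combination -hx + x * (x - φ) * h3
        simpa using this
      · apply h.ne_max
        have : 4 * (27 * ξ - φ ^ 3) = 0 := by
          linear_combination -27 * hx + (9 * x ^ 2 - 15 * φ * x + 4 * φ ^ 2) * h3
        simpa [sub_eq_zero] using this
  · intro x w hw h0 h1
    simp [gPoly, fPoly, hPoly, derivative_pow] at hw h0 h1
    by_cases hx : x = 0
    · subst hx
      have hw0 : w = 0 := by simpa using hw
      subst hw0
      simp [hc, h5, hξ] at h1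
    refine h.not_double_zero hx (w := w) (by linear_combination hw) ?_ ?_
    · refine mul_left_cancel₀ hc ?_
      linear_combination h0
    · refine mul_left_cancel₀ hc ?_
      linear_combination h1

/-- This is the tower in the coordinates s = 1/x, w/x², u/x³. For s ≠ 0 it reduces to
`IsNondegenerate.not_double_zero`; at s = 0 the coefficient a vanishes to order at least 2 and b to
order exactly 1, while w² = 1. -/
theorem IsNondegenerate.isSmoothTower_infty [CharZero k] {φ ξ c : k} (h : IsNondegenerate φ ξ)
    (hc : c ≠ 0) :
    IsSmoothTower (1 - C (2 * φ) * X + C (φ ^ 2) * X ^ 2 - C (4 * ξ) * X ^ 3)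
      (-C c * X ^ 2 * (C (7 * φ) - C (7 * φ ^ 2) * X - C (11 * ξ + 2 * φ ^ 3) * X ^ 2
        - C (7 * ξ * φ) * X ^ 3))
      (C (c * (2 * φ - 1)) * X * (2 - C φ * X + C ξ * X ^ 3)) := by
  have h5 := golden_sqrt_ne_zero h.golden
  have hξ := h.ne_zero
  constructor
  · intro s hs hs'
    simp [derivative_pow] at hs hs'
    have h2 : (1 - φ * s) * (3 - φ * s) = 0 := by linear_combination 3 * hs - s * hs'
    rcases mul_eq_zero.mp h2 with h3 | h3
    · have : 4 * ξ * s ^ 3 = 0 := by linear_combination -hs + (1 - φ * s) * h3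
      rcases mul_eq_zero.mp this with h4 | h4
      · exact hξ (by simpa using h4)
      · have : s = 0 := by simpa using h4
        simp [this] at hs
    · apply h.ne_max
      have hs0 : s ≠ 0 := by rintro rfl; simp at hs
      have : 4 * s ^ 3 * (27 * ξ - φ ^ 3) = 0 := by
        linear_combination -27 * hs + (9 - 15 * (φ * s) + 4 * (φ * s) ^ 2) * h3
      simpa [sub_eq_zero, hs0] using this
  · intro s w hw h0 h1
    simp [derivative_pow] at hw h0 h1
    by_cases hs : s = 0
    · subst hs
      simp [hc, h5] at h1
    obtain ⟨x, hx, rfl⟩ : ∃ x, x ≠ 0 ∧ s = x⁻¹ := ⟨s⁻¹, inv_ne_zero hs, (inv_inv s).symm⟩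
    obtain ⟨v, rfl⟩ : ∃ v, w = v / x ^ 2 := ⟨w * x ^ 2, by field_simp⟩
    field_simp at hw h0 h1
    refine h.not_double_zero hx (w := v) (by linear_combination hw) ?_ ?_
    · refine mul_left_cancel₀ hc ?_
      linear_combination h0
    · refine mul_left_cancel₀ (mul_ne_zero hc hx) ?_
      linear_combination 12 * v * h0 - x * h1
        - 12 * c * (2 * φ - 1) * (2 * x ^ 3 - φ * x ^ 2 + ξ) * hw

end Smoothness

/-! ### Recovering w and u from a root of the quartic. -/

section FunctionField

variable {k L : Type*} [Field k]

theorem curvePoly_natDegree {φ ξ : k} (hφ : φ ≠ 0) : (curvePolyRat φ ξ).natDegree = 4 := by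
  have hX : (RatFunc.X : RatFunc k) ≠ 0 := RatFunc.X_ne_zero
  have h5 : algebraMap k[X] (RatFunc k) (C φ) ≠ 0 := by simpa using hφ
  unfold curvePolyRat curvePoly
  simp only [Polynomial.map_sub, Polynomial.map_mul, Polynomial.map_pow, Polynomial.map_add,
    Polynomial.map_C, Polynomial.map_X, map_pow, RatFunc.algebraMap_X]
  compute_degree!

variable [Field L] [Algebra (RatFunc k) L] [Algebra k[X] L] [IsScalarTower k[X] (RatFunc k) L]

theorem algebraMap_polynomial_injective : Function.Injective (algebraMap k[X] L) := by
  rw [IsScalarTower.algebraMap_eq k[X] (RatFunc k) L]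
  exact (algebraMap (RatFunc k) L).injective.comp (IsFractionRing.injective k[X] (RatFunc k))

theorem aeval_curvePolyRat {φ ξ : k} (y : L) : aeval y (curvePolyRat φ ξ) =
    algebraMap k[X] L X * (y ^ 2 * algebraMap k[X] L (C φ) ^ 5
      + 10 * algebraMap k[X] L (fPoly φ ξ) * algebraMap k[X] L (gPoly φ ξ)) ^ 2
      - 500 * algebraMap k[X] L (hPoly φ ξ) ^ 2 * algebraMap k[X] L (gPoly φ ξ) ^ 3 := by
  unfold curvePolyRat curvePoly
  rw [aeval_map_algebraMap]
  simp only [map_sub, map_mul, map_add, map_pow, aeval_X, aeval_C, map_ofNat]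

theorem IsNondegenerate.gPoly_ne_zero [CharZero k] {φ ξ : k} (h : IsNondegenerate φ ξ) :
    gPoly φ ξ ≠ 0 := by
  intro h0
  have := congrArg (eval 0) h0
  simp [gPoly, h.ne_zero] at this

theorem IsNondegenerate.hPoly_ne_zero {φ ξ : k} (h : IsNondegenerate φ ξ) :
    hPoly φ ξ ≠ 0 := by
  intro h0
  have := congrArg (eval 0) h0
  simp [hPoly, h.ne_zero] at this

/-- A function field in which `F` has a root `y` contains the successive square roots `w`, `u`. -/
theorem IsNondegenerate.exists_tower [CharZero k] {φ ξ : k} (h : IsNondegenerate φ ξ) {y : L}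
    (hy : aeval y (curvePolyRat φ ξ) = 0) :
    ∃ w u : L, w ≠ 0 ∧ w ^ 2 = algebraMap k[X] L (X * gPoly φ ξ) ∧
      u ^ 2 = algebraMap k[X] L (-C (10 / φ ^ 5) * X * fPoly φ ξ)
        + algebraMap k[X] L (C (10 / φ ^ 5 * (2 * φ - 1)) * hPoly φ ξ) * w ∧
      w * algebraMap k[X] L (10 * C (2 * φ - 1) * hPoly φ ξ * gPoly φ ξ)
        = algebraMap k[X] L X * (y ^ 2 * algebraMap k[X] L (C φ) ^ 5
          + 10 * algebraMap k[X] L (fPoly φ ξ) * algebraMap k[X] L (gPoly φ ξ)) ∧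
      algebraMap k[X] L X * y = w * u := by
  have inj := algebraMap_polynomial_injective (k := k) (L := L)
  rw [aeval_curvePolyRat] at hy
  have hne : ∀ p : k[X], p ≠ 0 → algebraMap k[X] L p ≠ 0 := fun p hp h0 =>
    hp (inj (by rw [h0, map_zero]))
  have hx := hne X X_ne_zero
  have hg := hne _ h.gPoly_ne_zero
  have hh := hne _ h.hPoly_ne_zero
  have hφ := hne (C φ) (by simpa using golden_ne_zero h.golden)
  have hs := hne (C (2 * φ - 1)) (C_ne_zero.mpr (golden_sqrt_ne_zero h.golden))
  have h10 := hne 10 (by norm_num)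
  have hs2 : algebraMap k[X] L (C (2 * φ - 1)) ^ 2 = 5 := by
    rw [← map_pow, ← C_pow, show (2 * φ - 1) ^ 2 = 5 by linear_combination 4 * h.golden]
    simp only [map_ofNat]
  have hc : algebraMap k[X] L (C (10 / φ ^ 5)) * algebraMap k[X] L (C φ) ^ 5 = 10 := by
    rw [← map_pow, ← map_mul, ← C_pow, ← C_mul,
      div_mul_cancel₀ _ (pow_ne_zero 5 (golden_ne_zero h.golden))]
    simp only [map_ofNat]
  simp only [map_mul, map_neg, map_ofNat] at h10 ⊢
  set x := algebraMap k[X] L X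
  set f := algebraMap k[X] L (fPoly φ ξ)
  set g := algebraMap k[X] L (gPoly φ ξ)
  set d := algebraMap k[X] L (hPoly φ ξ)
  set s := algebraMap k[X] L (C (2 * φ - 1))
  set p := algebraMap k[X] L (C φ)
  set c := algebraMap k[X] L (C (10 / φ ^ 5))
  set W := y ^ 2 * p ^ 5 + 10 * f * g with hW
  have hW2 : x * W ^ 2 = 500 * d ^ 2 * g ^ 3 := by linear_combination hy
  have hden : 10 * s * d * g ≠ 0 := mul_ne_zero (mul_ne_zero (mul_ne_zero h10 hs) hh) hg
  -- Since s² = 5, the equation xW² = 500 d²g³ says precisely that xW/(10sdg) is a square root of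
  -- xg.
  have hw2 : (x * W / (10 * s * d * g)) ^ 2 = x * g := by
    rw [div_pow, div_eq_iff (pow_ne_zero 2 hden)]
    linear_combination x * hW2 - 100 * x * d ^ 2 * g ^ 3 * hs2
  have hw0 : x * W / (10 * s * d * g) ≠ 0 := by
    intro h0
    rw [h0] at hw2
    exact mul_ne_zero hx hg (by rw [← hw2]; ring)
  have hwW : (x * W / (10 * s * d * g)) * (10 * s * d * g) = x * W := div_mul_cancel₀ _ hden
  generalize x * W / (10 * s * d * g) = w at *
  refine ⟨w, x * y / w, hw0, hw2, ?_, hwW, by field_simp⟩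
  rw [div_pow, hw2, div_eq_iff (mul_ne_zero hx hg)]
  have hp : p ≠ 0 := hφ
  refine mul_left_cancel₀ (pow_ne_zero 5 hp) ?_
  linear_combination x ^ 2 * hW - x * hwW + (x * f - s * d * w) * x * g * hc

end FunctionField

/-! ### Irreducibility over an algebraically closed field of constants. -/

section Irreducible

variable {k L : Type*} [Field k] [IsAlgClosed k] [CharZero k]

theorem IsNondegenerate.tower_independent [Field L] [Algebra (RatFunc k) L] [Algebra k[X] L]
    [IsScalarTower k[X] (RatFunc k) L] {φ ξ c : k} (h : IsNondegenerate φ ξ) (hc : c ≠ 0) {w u : L}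
    (hw : w ^ 2 = algebraMap k[X] L (X * gPoly φ ξ))
    (hu : u ^ 2 = algebraMap k[X] L (-C c * X * fPoly φ ξ)
        + algebraMap k[X] L (C (c * (2 * φ - 1)) * hPoly φ ξ) * w) {α β γ δ : RatFunc k}
    (h0 : algebraMap (RatFunc k) L α + algebraMap (RatFunc k) L β * w
      + (algebraMap (RatFunc k) L γ + algebraMap (RatFunc k) L δ * w) * u = 0) :
    α = 0 ∧ β = 0 ∧ γ = 0 ∧ δ = 0 := by
  have hs := h.isSmoothTower hc
  have hdeg : ∃ x₀, (X * gPoly φ ξ).eval x₀ = 0 := ⟨0, by simp⟩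
  refine eq_zero_of_tower_combination_eq_zero (G := algebraMap k[X] (RatFunc k) (X * gPoly φ ξ))
    (a := algebraMap k[X] (RatFunc k) (-C c * X * fPoly φ ξ))
    (b := algebraMap k[X] (RatFunc k) (C (c * (2 * φ - 1)) * hPoly φ ξ)) ?_ ?_ ?_ ?_ h0
  · rw [hw, ← IsScalarTower.algebraMap_apply]
  · rw [hu, ← IsScalarTower.algebraMap_apply, ← IsScalarTower.algebraMap_apply]
  · exact sq_ne_algebraMap hs.simple_root hdeg
  · exact tower_ne_sq hs hdeg hw ⟨0, 0, by simp, by simp⟩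

theorem IsNondegenerate.tower_linearIndependent [Field L] [Algebra (RatFunc k) L] [Algebra k[X] L]
    [IsScalarTower k[X] (RatFunc k) L] {φ ξ c : k} (h : IsNondegenerate φ ξ) (hc : c ≠ 0) {w u : L}
    (hw : w ^ 2 = algebraMap k[X] L (X * gPoly φ ξ))
    (hu : u ^ 2 = algebraMap k[X] L (-C c * X * fPoly φ ξ)
        + algebraMap k[X] L (C (c * (2 * φ - 1)) * hPoly φ ξ) * w) :
    LinearIndependent (RatFunc k) ![1, w, u, w * u] := by
  rw [Fintype.linearIndependent_iff]
  intro c hc0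
  simp only [Fin.sum_univ_four, Algebra.smul_def] at hc0
  obtain ⟨h1, h2, h3, h4⟩ := h.tower_independent hc hw hu (α := c 0) (β := c 1) (γ := c 2)
    (δ := c 3) (by rw [← hc0]; simp; ring)
  intro i
  fin_cases i <;> assumption

/-- The field generated by a root of an irreducible factor contains the four independent elements 1,
w, u, wu. The factor thus has degree at least 4, the degree of the whole polynomial. -/
theorem IsNondegenerate.irreducible_of_isAlgClosed {φ ξ : k} (h : IsNondegenerate φ ξ) :
    Irreducible (curvePolyRat φ ξ) := by
  have hφ := golden_ne_zero h.golden
  have hd := curvePoly_natDegree (ξ := ξ) hφ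
  obtain ⟨p, hp, hpF⟩ := exists_irreducible_of_natDegree_ne_zero (f := curvePolyRat φ ξ) (by omega)
  have := Fact.mk hp
  obtain ⟨w, u, -, hw, hu, -⟩ := h.exists_tower (L := AdjoinRoot p) (y := AdjoinRoot.root p) (by
    obtain ⟨q, hq⟩ := hpF
    rw [hq, map_mul, AdjoinRoot.aeval_eq, AdjoinRoot.mk_self, zero_mul])
  have hli := h.tower_linearIndependent (div_ne_zero (by norm_num) (pow_ne_zero 5 hφ)) hw hu
  have : Module.Finite (RatFunc k) (AdjoinRoot p) := (AdjoinRoot.powerBasis hp.ne_zero).finite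
  have hcard := hli.fintype_card_le_finrank
  rw [(AdjoinRoot.powerBasis hp.ne_zero).finrank, AdjoinRoot.powerBasis_dim,
    Fintype.card_fin] at hcard
  have hF : curvePolyRat φ ξ ≠ 0 := by intro h0; simp [h0] at hd
  refine (associated_of_dvd_of_natDegree_le hpF hF (by omega)).irreducible hp

end Irreducible

/-! ### Descent of irreducibility to an arbitrary field of constants. -/

section Descent

variable {k k' : Type*} [Field k] [Field k']

theorem irreducible_of_irreducible_map_field (i : k →+* k') {p : k[X]}
    (h : Irreducible (p.map i)) : Irreducible p := by
  refine ⟨fun hu => h.not_isUnit (hu.map (mapRingHom i)), fun a b hab => ?_⟩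
  rw [hab, Polynomial.map_mul] at h
  refine (h.isUnit_or_isUnit rfl).imp ?_ ?_ <;>
  · intro hu
    rwa [isUnit_iff_degree_eq_zero, degree_map, ← isUnit_iff_degree_eq_zero] at hu

theorem exists_map_curvePolyRat (i : k →+* k') (φ ξ : k) :
    ∃ j : RatFunc k →+* RatFunc k', (curvePolyRat φ ξ).map j = curvePolyRat (i φ) (i ξ) := by
  have hinj : Function.Injective ((algebraMap k'[X] (RatFunc k')).comp (mapRingHom i)) :=
    (IsFractionRing.injective k'[X] (RatFunc k')).comp (map_injective i i.injective)
  refine ⟨IsFractionRing.lift hinj, ?_⟩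
  have hcomp : (IsFractionRing.lift hinj).comp (algebraMap k[X] (RatFunc k))
      = (algebraMap k'[X] (RatFunc k')).comp (mapRingHom i) := by
    exact RingHom.ext fun x => IsFractionRing.lift_algebraMap hinj x
  have hcurve : (curvePoly φ ξ).map (mapRingHom i) = curvePoly (i φ) (i ξ) := by
    simp [curvePoly, fPoly, gPoly, hPoly, map_ofNat]
  rw [curvePolyRat, Polynomial.map_map, hcomp, ← Polynomial.map_map, hcurve, curvePolyRat]

theorem IsNondegenerate.irreducible [CharZero k] {φ ξ : k}
    (h : IsNondegenerate φ ξ) : Irreducible (curvePolyRat φ ξ) := by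
  let i := algebraMap k (AlgebraicClosure k)
  have : CharZero (AlgebraicClosure k) := charZero_of_injective_algebraMap i.injective
  obtain ⟨j, hj⟩ := exists_map_curvePolyRat i φ ξ
  exact irreducible_of_irreducible_map_field j (hj ▸ (h.map_ringHom i).irreducible_of_isAlgClosed)

theorem IsNondegenerate.finrank_adjoinRoot [CharZero k] {φ ξ : k} (h : IsNondegenerate φ ξ) :
    Module.finrank (RatFunc k) (AdjoinRoot (curvePolyRat φ ξ)) = 4 := by
  rw [(AdjoinRoot.powerBasis h.irreducible.ne_zero).finrank, AdjoinRoot.powerBasis_dim,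
    curvePoly_natDegree (golden_ne_zero h.golden)]

end Descent

/-! ### Dimensions of spans of subsets of an independent family. -/

section SpanOfIndependent

variable {k V ι : Type*} [Field k] [AddCommGroup V] [Module k V] {e : ι → V}

theorem span_image_inf (he : LinearIndependent k e) (S T : Set ι) :
    Submodule.span k (e '' S) ⊓ Submodule.span k (e '' T) = Submodule.span k (e '' (S ∩ T)) := by
  simp only [Finsupp.span_image_eq_map_linearCombination, Finsupp.supported_inter]
  rw [Submodule.map_inf _ he]

theorem span_image_sup (S T : Set ι) :
    Submodule.span k (e '' S) ⊔ Submodule.span k (e '' T) = Submodule.span k (e '' (S ∪ T)) := by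
  rw [Set.image_union, Submodule.span_union]

theorem finite_and_finrank_span_image (he : LinearIndependent k e) (T : Finset ι) :
    Module.Finite k (Submodule.span k (e '' (T : Set ι))) ∧
      Module.finrank k (Submodule.span k (e '' (T : Set ι))) = T.card := by
  have h : e '' (T : Set ι) = Set.range fun i : T => e i := by
    rw [Set.image_eq_range]; rfl
  rw [h]
  have hli : LinearIndependent k fun i : T => e i := he.comp _ Subtype.val_injective
  exact ⟨Module.Finite.span_of_finite k (Set.finite_range _), by
    rw [finrank_span_eq_card hli, Fintype.card_coe]⟩

/-- The vectors indexed by the complement of S span a complement of the subspace, so the quotient is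
isomorphic to their span. -/
theorem finite_and_finrank_span_quotient (he : LinearIndependent k e) (S : Set ι) (T : Finset ι)
    (hST : Sᶜ = T) :
    Module.Finite k (↥(Submodule.span k (Set.range e)) ⧸
        (Submodule.span k (e '' S)).submoduleOf (Submodule.span k (Set.range e))) ∧
      Module.finrank k (↥(Submodule.span k (Set.range e)) ⧸
        (Submodule.span k (e '' S)).submoduleOf (Submodule.span k (Set.range e))) = T.card := by
  obtain ⟨hf, hr⟩ := finite_and_finrank_span_image he T
  set U := Submodule.span k (Set.range e)
  have hS : Submodule.span k (e '' S) ≤ U := Submodule.span_mono (Set.image_subset_range _ _)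
  have hT : Submodule.span k (e '' (T : Set ι)) ≤ U :=
    Submodule.span_mono (Set.image_subset_range _ _)
  have hc : IsCompl ((Submodule.span k (e '' S)).submoduleOf U)
      ((Submodule.span k (e '' (T : Set ι))).submoduleOf U) := by
    constructor
    · rw [disjoint_iff]
      apply Submodule.map_injective_of_injective U.subtype_injective
      rw [Submodule.submoduleOf, Submodule.submoduleOf, ← Submodule.comap_inf, span_image_inf he,
        ← hST, Set.inter_compl_self]
      simp
    · rw [codisjoint_iff, ← Submodule.submoduleOf_sup_of_le hS hT, span_image_sup, ← hST,
        Set.union_compl_self, Set.image_univ]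
      exact Submodule.submoduleOf_self _
  let E := (Submodule.quotientEquivOfIsCompl _ _ hc).trans (Submodule.submoduleOfEquivOfLe hT)
  exact ⟨Module.Finite.equiv E.symm, by rw [E.finrank_eq, hr]⟩

end SpanOfIndependent

/-! ### Independence of the powers of X. -/

section LaurentMonomials

variable {k : Type*} [Field k]

theorem linearIndependent_zpow_X : LinearIndependent k fun n : ℤ => (RatFunc.X : RatFunc k) ^ n := by
  have hX : (RatFunc.X : RatFunc k) ≠ 0 := RatFunc.X_ne_zero
  rw [linearIndependent_iff']
  intro s c hs n hn
  -- Multiplying by X ^ N turns the relation between Laurent monomials into one between polynomials.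
  obtain ⟨N, hN⟩ : ∃ N : ℕ, ∀ i ∈ s, 0 ≤ i + N := by
    obtain ⟨b, hb⟩ := s.bddBelow
    exact ⟨(-b).toNat, fun i hi => by have := hb hi; omega⟩
  have h0 : ∑ i ∈ s, C (c i) * X ^ (i + N).toNat = 0 := by
    apply IsFractionRing.injective k[X] (RatFunc k)
    rw [map_zero, map_sum, ← zero_mul (RatFunc.X ^ N : RatFunc k), ← hs, Finset.sum_mul]
    refine Finset.sum_congr rfl fun i hi => ?_
    rw [map_mul, map_pow, RatFunc.algebraMap_X, RatFunc.algebraMap_C, ← zpow_natCast,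
      Int.toNat_of_nonneg (hN i hi), zpow_add₀ hX, zpow_natCast, ← RatFunc.smul_eq_C_mul,
      smul_mul_assoc]
  have h1 := congrArg (fun p => coeff p (n + N).toNat) h0
  simp only [finsetSum_coeff, coeff_C_mul, coeff_X_pow, coeff_zero] at h1
  rw [Finset.sum_eq_single n] at h1
  · simpa using h1
  · intro i hi hne
    rw [if_neg, mul_zero]
    intro h
    have := hN i hi
    have := hN n hn
    omega
  · exact fun h => absurd hn h

end LaurentMonomials

/-! ### Integrality over k[t] and over k[t, 1/t]. -/

section IntegralElements

variable {k L : Type*} [Field k] [Field L] [Algebra k L]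

/-- The coefficients of a monic equation lift along f, and the lift can be chosen monic. -/
theorem isIntegralElem_of_isIntegral_subalgebra {R : Type*} [CommRing R] (S : Subalgebra k L)
    (f : R →+* L) (hS : ∀ s ∈ S, s ∈ f.range) {b : L} (hb : IsIntegral S b) :
    f.IsIntegralElem b := by
  obtain ⟨p, hp, hpb⟩ := hb
  have hl : p.map (algebraMap S L) ∈ lifts f := by
    rw [lifts_iff_coeff_lifts]
    intro n
    rw [coeff_map]
    exact hS _ (p.coeff n).2
  obtain ⟨q, hq, -, hqm⟩ := lifts_and_degree_eq_and_monic hl (hp.map _)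
  exact ⟨q, hqm, by rw [eval₂_eq_eval_map, hq, ← eval₂_eq_eval_map, hpb]⟩

theorem isIntegral_subalgebra_of_isIntegralElem {R : Type*} [CommRing R] (S : Subalgebra k L)
    (f : R →+* L) (hS : ∀ r, f r ∈ S) {b : L} (hb : f.IsIntegralElem b) : IsIntegral S b := by
  have : f = (algebraMap S L).comp (f.codRestrict S hS) := rfl
  rw [this] at hb
  exact hb.of_comp

theorem mem_integralSpace_iff {s : Set L} {b : L} :
    b ∈ integralSpace k s ↔ IsIntegral (Algebra.adjoin k s) b := Iff.rfl

theorem mem_integralSpace_singleton {t b : L} (f : k[X] →+* L)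
    (hf : f = (aeval t : k[X] →ₐ[k] L).toRingHom) :
    b ∈ integralSpace k {t} ↔ f.IsIntegralElem b := by
  subst hf
  rw [mem_integralSpace_iff]
  constructor
  · refine isIntegralElem_of_isIntegral_subalgebra _ _ fun s hs => ?_
    rwa [Algebra.adjoin_singleton_eq_range_aeval] at hs
  · refine isIntegral_subalgebra_of_isIntegralElem _ _ fun r => ?_
    rw [Algebra.adjoin_singleton_eq_range_aeval]
    exact ⟨r, rfl⟩

theorem integralSpace_mono {s t : Set L} (h : s ⊆ t) : integralSpace k s ≤ integralSpace k t := by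
  intro b hb
  rw [mem_integralSpace_iff] at hb ⊢
  refine isIntegral_subalgebra_of_isIntegralElem _ (algebraMap (Algebra.adjoin k s) L)
    (fun r => Algebra.adjoin_mono h r.2) hb

theorem mul_mem_integralSpace {s : Set L} {a b : L} (ha : a ∈ Algebra.adjoin k s)
    (hb : b ∈ integralSpace k s) : a * b ∈ integralSpace k s := by
  rw [mem_integralSpace_iff] at hb ⊢
  exact (isIntegral_algebraMap (x := (⟨a, ha⟩ : Algebra.adjoin k s))).mul hb

/-- A function that is integral over `k[t, 1/t]` becomes integral over `k[t]` after multiplication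
by a power of `t`. -/
theorem exists_pow_mul_mem_integralSpace {t b : L} (ht : t ≠ 0)
    (hb : b ∈ integralSpace k {t, t⁻¹}) : ∃ n : ℕ, t ^ n * b ∈ integralSpace k {t} := by
  let : Algebra k[X] L := (aeval t : k[X] →ₐ[k] L).toRingHom.toAlgebra
  have hX : algebraMap k[X] L X = t := aeval_X t
  have hC : ∀ r, algebraMap k[X] L (C r) = algebraMap k L r := fun r => aeval_C t r
  have hunit : IsUnit (algebraMap k[X] L X) := by rw [hX]; exact ht.isUnit
  let : Algebra (LaurentPolynomial k) L := (IsLocalization.Away.lift (X : k[X]) hunit).toAlgebra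
  have hlift : ∀ p : k[X], algebraMap (LaurentPolynomial k) L (algebraMap k[X] (LaurentPolynomial k) p)
      = algebraMap k[X] L p := fun p => IsLocalization.Away.lift_eq (X : k[X]) hunit p
  have : IsScalarTower k[X] (LaurentPolynomial k) L := IsScalarTower.of_algebraMap_eq fun p => (hlift p).symm
  have hT : algebraMap (LaurentPolynomial k) L (LaurentPolynomial.T 1) = t := by
    rw [← hX, ← hlift]; simp
  rw [mem_integralSpace_iff] at hb
  have hint : IsIntegral (LaurentPolynomial k) b := by
    refine isIntegralElem_of_isIntegral_subalgebra _ (algebraMap (LaurentPolynomial k) L) ?_ hb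
    intro s hs
    induction hs using Algebra.adjoin_induction with
    | mem x hx =>
      rcases hx with rfl | rfl
      · exact ⟨_, hT⟩
      · refine ⟨LaurentPolynomial.T (-1), eq_inv_of_mul_eq_one_left ?_⟩
        rw [← hT, ← map_mul, ← LaurentPolynomial.T_add]; simp
    | algebraMap r => exact ⟨_, (hlift (C r)).trans (hC r)⟩
    | add x y _ _ hx hy => exact add_mem hx hy
    | mul x y _ _ hx hy => exact mul_mem hx hy
  obtain ⟨⟨_, n, rfl⟩, hm⟩ := IsIntegral.exists_multiple_integral_of_isLocalization
    (Submonoid.powers (X : k[X])) b hint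
  refine ⟨n, (mem_integralSpace_singleton (algebraMap k[X] L) rfl).mpr ?_⟩
  rw [Submonoid.smul_def, Algebra.smul_def] at hm
  change IsIntegral k[X] _
  simpa [hX] using hm

end IntegralElements

/-! ### Transport to the coordinate 1/x. -/

section Tower

/-- `isIntegral_tower_iff` for an arbitrary coordinate function on the projective line. -/
theorem isIntegralElem_tower_iff {k K L : Type*} [Field k] [IsAlgClosed k] [CharZero k] [Field K]
    [Field L] [Algebra K L] (f : k[X] →+* K) (hf : Function.Injective f)
    (hsurj : ∀ z, ∃ n d, z = f n / f d) {G a b : k[X]} (hs : IsSmoothTower G a b)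
    (hdeg : ∃ x₀, G.eval x₀ = 0) {w u : L} (hw : w ^ 2 = algebraMap K L (f G))
    (hu : u ^ 2 = algebraMap K L (f a) + algebraMap K L (f b) * w)
    (σ : L →ₐ[K] L) (σw : σ w = w) (σu : σ u = -u) (α β γ δ : K) :
    ((algebraMap K L).comp f).IsIntegralElem (algebraMap K L α + algebraMap K L β * w
      + (algebraMap K L γ + algebraMap K L δ * w) * u) ↔
    (α ∈ f.range ∧ β ∈ f.range ∧ γ ∈ f.range ∧ δ ∈ f.range) := by
  let : Algebra k[X] K := f.toAlgebra
  let : Algebra k[X] L := ((algebraMap K L).comp f).toAlgebra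
  have : IsScalarTower k[X] K L := IsScalarTower.of_algebraMap_eq fun _ => rfl
  have : FaithfulSMul k[X] K := (faithfulSMul_iff_algebraMap_injective _ _).mpr hf
  have : IsFractionRing k[X] K := IsFractionRing.of_field _ _ hsurj
  exact isIntegral_tower_iff hs hdeg hw hu σ σw σu α β γ δ

variable {k : Type*} [Field k]

/-- The substitution `X ↦ 1/X`. -/
noncomputable def invX (k : Type*) [Field k] : k[X] →+* RatFunc k :=
  (aeval (RatFunc.X : RatFunc k)⁻¹ : k[X] →ₐ[k] RatFunc k).toRingHom

theorem invX_X : invX k X = (RatFunc.X)⁻¹ := aeval_X _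

theorem invX_C (a : k) : invX k (C a) = RatFunc.C a := aeval_C _ a

theorem algebraMap_eq_reverse_div (p : k[X]) :
    algebraMap k[X] (RatFunc k) p = invX k p.reverse / invX k (X ^ p.natDegree) := by
  have hX : (RatFunc.X : RatFunc k) ≠ 0 := RatFunc.X_ne_zero
  let := invertibleOfNonzero hX
  have h := eval₂_reverse_mul_pow (algebraMap k (RatFunc k)) RatFunc.X p
  rw [invOf_eq_inv] at h
  rw [map_pow, invX_X, inv_pow, div_inv_eq_mul]
  refine Eq.trans ?_ h.symm
  change algebraMap k[X] (RatFunc k) p = aeval RatFunc.X p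
  rw [← RatFunc.algebraMap_X, aeval_algebraMap_apply, aeval_X_left_apply]

theorem invX_injective : Function.Injective (invX k) := by
  rw [injective_iff_map_eq_zero]
  intro p hp
  have hX : (RatFunc.X : RatFunc k) ≠ 0 := RatFunc.X_ne_zero
  let := invertibleOfNonzero (inv_ne_zero hX)
  have h := eval₂_reverse_mul_pow (algebraMap k (RatFunc k)) (RatFunc.X)⁻¹ p
  rw [invOf_eq_inv, inv_inv] at h
  replace h := h.trans hp
  have h' : aeval RatFunc.X p.reverse = (0 : RatFunc k) :=
    (mul_eq_zero.mp h).resolve_right (pow_ne_zero _ (inv_ne_zero hX))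
  rw [← RatFunc.algebraMap_X, aeval_algebraMap_apply, aeval_X_left_apply] at h'
  rw [← reverse_eq_zero]
  exact IsFractionRing.injective k[X] (RatFunc k) (by rw [h', map_zero])

theorem exists_eq_invX_div (z : RatFunc k) : ∃ n d, z = invX k n / invX k d := by
  obtain ⟨n, d, -, rfl⟩ := IsFractionRing.div_surjective (A := k[X]) z
  refine ⟨n.reverse * X ^ d.natDegree, d.reverse * X ^ n.natDegree, ?_⟩
  rw [algebraMap_eq_reverse_div n, algebraMap_eq_reverse_div d, map_mul, map_mul, div_div_div_eq,
    mul_comm (invX k (X ^ n.natDegree))]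

end Tower

/-! ### Laurent monomials times 1, w, u, wu. -/

section LaurentBasis

variable {k L : Type*} [Field k] [Field L] [Algebra (RatFunc k) L] [Algebra k L]
  [IsScalarTower k (RatFunc k) L]

/-- The products of the powers of `X` with the four elements `1, w, u, wu`. -/
noncomputable def laurentBasis (w u : L) (p : ℤ × Fin 4) : L :=
  (RatFunc.X : RatFunc k) ^ p.1 • (![1, w, u, w * u] : Fin 4 → L) p.2

/-- The orders of the poles of `1, w, u, wu` over `x = ∞`. -/
def poleOrder : Fin 4 → ℕ := ![0, 2, 3, 5]

theorem algebraMap_mem_span_zpow (p : k[X]) : algebraMap k[X] (RatFunc k) p ∈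
    Submodule.span k ((fun n : ℤ => (RatFunc.X : RatFunc k) ^ n) '' {n | 0 ≤ n}) := by
  rw [← aeval_X_left_apply (R := k) p, ← aeval_algebraMap_apply, RatFunc.algebraMap_X,
    aeval_eq_sum_range]
  refine Submodule.sum_mem _ fun i _ => Submodule.smul_mem _ _ (Submodule.subset_span ?_)
  exact ⟨i, Int.natCast_nonneg i, zpow_natCast _ _⟩

theorem mem_span_zpow_of_mul_mem {m : ℕ} {c : RatFunc k}
    (h : c * RatFunc.X ^ m ∈ (invX k).range) : c ∈
    Submodule.span k ((fun n : ℤ => (RatFunc.X : RatFunc k) ^ n) '' {n | n ≤ -(m : ℤ)}) := by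
  have hX : (RatFunc.X : RatFunc k) ≠ 0 := RatFunc.X_ne_zero
  obtain ⟨p, hp⟩ := h
  have hc : c = (RatFunc.X : RatFunc k)⁻¹ ^ m * aeval (RatFunc.X : RatFunc k)⁻¹ p := by
    change _ = _ * invX k p
    rw [hp, inv_pow]; field_simp
  rw [hc, aeval_eq_sum_range, Finset.mul_sum]
  refine Submodule.sum_mem _ fun i _ => ?_
  rw [mul_smul_comm]
  refine Submodule.smul_mem _ _ (Submodule.subset_span ⟨-((m : ℤ) + i), ?_, ?_⟩)
  · simp
  · beta_reduce
    rw [← pow_add, zpow_neg, ← Nat.cast_add, zpow_natCast, inv_pow]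

theorem smul_mem_span_laurentBasis {w u : L} {S : Set ℤ} {T : Set (ℤ × Fin 4)} {c : RatFunc k}
    (hc : c ∈ Submodule.span k ((fun n : ℤ => (RatFunc.X : RatFunc k) ^ n) '' S)) (j : Fin 4)
    (hST : ∀ n ∈ S, (n, j) ∈ T) : c • (![1, w, u, w * u] : Fin 4 → L) j ∈
      Submodule.span k (laurentBasis (k := k) w u '' T) := by
  induction hc using Submodule.span_induction with
  | mem x hx =>
    obtain ⟨n, hn, rfl⟩ := hx
    exact Submodule.subset_span ⟨(n, j), hST n hn, rfl⟩
  | zero => simp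
  | add x y _ _ hx hy => rw [add_smul]; exact add_mem hx hy
  | smul a x _ hx => rw [smul_assoc]; exact Submodule.smul_mem _ _ hx

theorem tower_eq_sum {k L : Type*} [Field k] [Field L] [Algebra (RatFunc k) L] (w u : L) (α β γ δ : RatFunc k) :
    algebraMap (RatFunc k) L α + algebraMap (RatFunc k) L β * w
      + (algebraMap (RatFunc k) L γ + algebraMap (RatFunc k) L δ * w) * u
    = ∑ j, (![α, β, γ, δ] : Fin 4 → RatFunc k) j • (![1, w, u, w * u] : Fin 4 → L) j := by
  simp only [Fin.sum_univ_four, Algebra.smul_def]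
  simp
  ring

theorem tower_mem_span_laurentBasis {w u : L} {S : Fin 4 → Set ℤ} {α β γ δ : RatFunc k}
    (h : ∀ j, (![α, β, γ, δ] : Fin 4 → RatFunc k) j ∈
      Submodule.span k ((fun n : ℤ => (RatFunc.X : RatFunc k) ^ n) '' S j)) :
    algebraMap (RatFunc k) L α + algebraMap (RatFunc k) L β * w
      + (algebraMap (RatFunc k) L γ + algebraMap (RatFunc k) L δ * w) * u ∈
    Submodule.span k (laurentBasis (k := k) w u '' {p | p.1 ∈ S p.2}) := by
  rw [tower_eq_sum]
  exact Submodule.sum_mem _ fun j _ => smul_mem_span_laurentBasis (h j) j fun n hn => hn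

end LaurentBasis

/-! ### The coordinate rings of the two charts and of their overlap. -/

section Charts

variable {k L : Type*} [Field k] [IsAlgClosed k] [CharZero k] [Field L] [Algebra (RatFunc k) L]
  [Algebra k L] [IsScalarTower k (RatFunc k) L]

theorem infty_identities {k : Type*} [Field k] (φ ξ c : k) :
    (RatFunc.X⁻¹ : RatFunc k) ^ 4 * algebraMap k[X] (RatFunc k) (X * gPoly φ ξ)
      = invX k (1 - C (2 * φ) * X + C (φ ^ 2) * X ^ 2 - C (4 * ξ) * X ^ 3) ∧
    (RatFunc.X⁻¹ : RatFunc k) ^ 6 * algebraMap k[X] (RatFunc k) (-C c * X * fPoly φ ξ)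
      = invX k (-C c * X ^ 2 * (C (7 * φ) - C (7 * φ ^ 2) * X - C (11 * ξ + 2 * φ ^ 3) * X ^ 2
        - C (7 * ξ * φ) * X ^ 3)) ∧
    (RatFunc.X⁻¹ : RatFunc k) ^ 4
        * algebraMap k[X] (RatFunc k) (C (c * (2 * φ - 1)) * hPoly φ ξ)
      = invX k (C (c * (2 * φ - 1)) * X * (2 - C φ * X + C ξ * X ^ 3)) := by
  have hX : (RatFunc.X : RatFunc k) ≠ 0 := RatFunc.X_ne_zero
  refine ⟨?_, ?_, ?_⟩ <;>
  · simp only [gPoly, fPoly, hPoly, map_mul, map_sub, map_add, map_neg, map_pow, map_one, map_ofNat,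
      invX_X, invX_C, RatFunc.algebraMap_X, RatFunc.algebraMap_C]
    field_simp
    try ring

/-- In each chart, `isIntegralElem_tower_iff` reduces integrality to the four coefficients. Near
infinity the integral basis is 1, w/x², u/x³, wu/x⁵, whence the bounds by `poleOrder`. On the
overlap, a power of x carries every element into the chart x ≠ ∞. -/
theorem IsNondegenerate.integralSpaces_eq_span {φ ξ c : k} (h : IsNondegenerate φ ξ) (hc : c ≠ 0)
    {w u : L} (hw : w ^ 2 = algebraMap (RatFunc k) L (algebraMap k[X] (RatFunc k) (X * gPoly φ ξ)))
    (hu : u ^ 2 = algebraMap (RatFunc k) L (algebraMap k[X] (RatFunc k) (-C c * X * fPoly φ ξ))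
        + algebraMap (RatFunc k) L
          (algebraMap k[X] (RatFunc k) (C (c * (2 * φ - 1)) * hPoly φ ξ)) * w)
    (σ : L →ₐ[RatFunc k] L) (σw : σ w = w) (σu : σ u = -u)
    (hspan : ∀ b : L, ∃ α β γ δ : RatFunc k, b = algebraMap (RatFunc k) L α
      + algebraMap (RatFunc k) L β * w
      + (algebraMap (RatFunc k) L γ + algebraMap (RatFunc k) L δ * w) * u) :
    integralSpace k {algebraMap (RatFunc k) L RatFunc.X}
      = Submodule.span k (laurentBasis (k := k) w u '' {p | 0 ≤ p.1}) ∧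
    integralSpace k {algebraMap (RatFunc k) L RatFunc.X⁻¹}
      = Submodule.span k (laurentBasis (k := k) w u '' {p | p.1 ≤ -(poleOrder p.2 : ℤ)}) ∧
    integralSpace k {algebraMap (RatFunc k) L RatFunc.X, algebraMap (RatFunc k) L RatFunc.X⁻¹}
      = Submodule.span k (Set.range (laurentBasis (k := k) w u)) := by
  have hX : (RatFunc.X : RatFunc k) ≠ 0 := RatFunc.X_ne_zero
  have hXL : algebraMap (RatFunc k) L RatFunc.X ≠ 0 := by simpa using hX
  have h0 : ∀ α β γ δ : RatFunc k, algebraMap (RatFunc k) L α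
      + algebraMap (RatFunc k) L β * w
      + (algebraMap (RatFunc k) L γ + algebraMap (RatFunc k) L δ * w) * u ∈
        integralSpace k {algebraMap (RatFunc k) L RatFunc.X} ↔ _ := fun α β γ δ =>
    (mem_integralSpace_singleton ((algebraMap (RatFunc k) L).comp (algebraMap k[X] (RatFunc k)))
      (by
        ext a
        · simpa using (IsScalarTower.algebraMap_apply k (RatFunc k) L a).symm
        · simp)).trans
    (isIntegralElem_tower_iff (algebraMap k[X] (RatFunc k))
      (IsFractionRing.injective k[X] (RatFunc k))
      (fun z => by
        obtain ⟨n, d, -, h⟩ := IsFractionRing.div_surjective (A := k[X]) z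
        exact ⟨n, d, h.symm⟩)
      (h.isSmoothTower hc) ⟨0, by simp⟩ hw hu σ σw σu α β γ δ)
  obtain ⟨i1, i2, i3⟩ := infty_identities φ ξ c
  have h1 : ∀ α β γ δ : RatFunc k, algebraMap (RatFunc k) L α
      + algebraMap (RatFunc k) L β * w
      + (algebraMap (RatFunc k) L γ + algebraMap (RatFunc k) L δ * w) * u ∈
        integralSpace k {algebraMap (RatFunc k) L RatFunc.X⁻¹} ↔
      (α * RatFunc.X ^ 0 ∈ (invX k).range ∧ β * RatFunc.X ^ 2 ∈ (invX k).range ∧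
        γ * RatFunc.X ^ 3 ∈ (invX k).range ∧ δ * RatFunc.X ^ 5 ∈ (invX k).range) := by
    intro α β γ δ
    obtain ⟨s0, hs0⟩ := IsAlgClosed.exists_root
      (1 - C (2 * φ) * X + C (φ ^ 2) * X ^ 2 - C (4 * ξ) * X ^ 3) (by
        have : -(4 * ξ) ≠ 0 := neg_ne_zero.mpr (mul_ne_zero (by norm_num) h.ne_zero)
        have hd : (1 - C (2 * φ) * X + C (φ ^ 2) * X ^ 2 - C (4 * ξ) * X ^ 3).degree = 3 := by
          compute_degree!
          exact h.ne_zero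
        rw [hd]; norm_num)
    have key := isIntegralElem_tower_iff (L := L) (invX k) invX_injective exists_eq_invX_div
      (h.isSmoothTower_infty hc) ⟨s0, hs0⟩
      (w := algebraMap (RatFunc k) L (RatFunc.X⁻¹ ^ 2) * w)
      (u := algebraMap (RatFunc k) L (RatFunc.X⁻¹ ^ 3) * u)
      (by rw [← i1, mul_pow, hw]; simp only [map_mul, map_pow]; ring)
      (by rw [← i2, ← i3, mul_pow, hu]; simp only [map_mul, map_pow]; ring)
      σ (by rw [map_mul, σw, AlgHom.commutes]) (by rw [map_mul, σu, AlgHom.commutes, mul_neg])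
      (α * RatFunc.X ^ 0) (β * RatFunc.X ^ 2) (γ * RatFunc.X ^ 3) (δ * RatFunc.X ^ 5)
    rw [← key, mem_integralSpace_singleton ((algebraMap (RatFunc k) L).comp (invX k))
      (by
        ext a
        · simpa [invX_C] using (IsScalarTower.algebraMap_apply k (RatFunc k) L a).symm
        · simp [invX_X])]
    refine iff_of_eq (congrArg _ ?_)
    simp only [map_mul, map_pow, map_inv₀]
    field_simp
  have hle0 : Submodule.span k (laurentBasis (k := k) w u '' {p | 0 ≤ p.1}) ≤
      integralSpace k {algebraMap (RatFunc k) L RatFunc.X} := by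
    rw [Submodule.span_le]
    rintro _ ⟨⟨n, j⟩, hn, rfl⟩
    obtain ⟨m, rfl⟩ := Int.eq_ofNat_of_zero_le hn
    have hr : (RatFunc.X : RatFunc k) ^ (m : ℤ) ∈ (algebraMap k[X] (RatFunc k)).range :=
      ⟨X ^ m, by simp⟩
    have hz := zero_mem (algebraMap k[X] (RatFunc k)).range
    fin_cases j
    · simpa [laurentBasis, Algebra.smul_def] using (h0 _ 0 0 0).mpr ⟨hr, hz, hz, hz⟩
    · simpa [laurentBasis, Algebra.smul_def] using (h0 0 _ 0 0).mpr ⟨hz, hr, hz, hz⟩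
    · simpa [laurentBasis, Algebra.smul_def] using (h0 0 0 _ 0).mpr ⟨hz, hz, hr, hz⟩
    · simpa [laurentBasis, Algebra.smul_def, mul_assoc] using
        (h0 0 0 0 _).mpr ⟨hz, hz, hz, hr⟩
  have heq0 : integralSpace k {algebraMap (RatFunc k) L RatFunc.X}
      = Submodule.span k (laurentBasis (k := k) w u '' {p | 0 ≤ p.1}) := by
    refine le_antisymm (fun b hb => ?_) hle0
    obtain ⟨α, β, γ, δ, rfl⟩ := hspan b
    obtain ⟨⟨a1, rfl⟩, ⟨a2, rfl⟩, ⟨a3, rfl⟩, ⟨a4, rfl⟩⟩ := (h0 α β γ δ).mp hb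
    refine tower_mem_span_laurentBasis (S := fun _ => {n | 0 ≤ n}) fun j => ?_
    fin_cases j <;> exact algebraMap_mem_span_zpow _
  refine ⟨heq0, ?_, ?_⟩
  · apply le_antisymm
    · intro b hb
      obtain ⟨α, β, γ, δ, rfl⟩ := hspan b
      obtain ⟨a1, a2, a3, a4⟩ := (h1 α β γ δ).mp hb
      refine tower_mem_span_laurentBasis (S := fun j => {n | n ≤ -(poleOrder j : ℤ)}) fun j => ?_
      fin_cases j
      · exact mem_span_zpow_of_mul_mem a1
      · exact mem_span_zpow_of_mul_mem a2
      · exact mem_span_zpow_of_mul_mem a3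
      · exact mem_span_zpow_of_mul_mem a4
    · rw [Submodule.span_le]
      rintro _ ⟨⟨n, j⟩, hn, rfl⟩
      have hr : (RatFunc.X : RatFunc k) ^ n * RatFunc.X ^ (poleOrder j) ∈ (invX k).range := by
        obtain ⟨m, hm⟩ : ∃ m : ℕ, n = -((poleOrder j : ℤ) + m) :=
          ⟨(-n - poleOrder j).toNat, by simp at hn; omega⟩
        refine ⟨X ^ m, ?_⟩
        rw [hm, map_pow, invX_X, zpow_neg, zpow_add₀ hX, zpow_natCast, zpow_natCast, inv_pow]
        field_simp
      have hz : ∀ m, (0 : RatFunc k) * RatFunc.X ^ m ∈ (invX k).range := fun m => by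
        rw [zero_mul]; exact zero_mem _
      fin_cases j
      · simpa [laurentBasis, Algebra.smul_def] using (h1 _ 0 0 0).mpr ⟨hr, hz _, hz _, hz _⟩
      · simpa [laurentBasis, Algebra.smul_def] using (h1 0 _ 0 0).mpr ⟨hz _, hr, hz _, hz _⟩
      · simpa [laurentBasis, Algebra.smul_def] using (h1 0 0 _ 0).mpr ⟨hz _, hz _, hr, hz _⟩
      · simpa [laurentBasis, Algebra.smul_def, mul_assoc] using
          (h1 0 0 0 _).mpr ⟨hz _, hz _, hz _, hr⟩
  · have hinv : algebraMap (RatFunc k) L RatFunc.X⁻¹ = (algebraMap (RatFunc k) L RatFunc.X)⁻¹ :=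
      map_inv₀ _ _
    rw [hinv]
    apply le_antisymm
    · intro b hb
      obtain ⟨N, hN⟩ := exists_pow_mul_mem_integralSpace hXL hb
      rw [heq0] at hN
      have hb' : b = (RatFunc.X : RatFunc k) ^ (-(N : ℤ)) •
          (algebraMap (RatFunc k) L RatFunc.X ^ N * b) := by
        rw [Algebra.smul_def, zpow_neg, zpow_natCast, map_inv₀, map_pow]
        field_simp
      rw [hb']
      generalize algebraMap (RatFunc k) L RatFunc.X ^ N * b = b' at hN
      induction hN using Submodule.span_induction with
      | mem x hx =>
        obtain ⟨⟨n, j⟩, -, rfl⟩ := hx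
        refine Submodule.subset_span ⟨(-(N : ℤ) + n, j), ?_⟩
        simp only [laurentBasis]
        rw [zpow_add₀ hX, mul_smul]
      | zero => simp
      | add x y _ _ hx hy => rw [smul_add]; exact add_mem hx hy
      | smul a x _ hx => rw [smul_comm]; exact Submodule.smul_mem _ _ hx
    · rw [Submodule.span_le]
      rintro _ ⟨⟨n, j⟩, rfl⟩
      have h2 : laurentBasis (k := k) w u (0, j) ∈ integralSpace k
          {algebraMap (RatFunc k) L RatFunc.X, (algebraMap (RatFunc k) L RatFunc.X)⁻¹} :=
        integralSpace_mono (by simp)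
          (hle0 (Submodule.subset_span ⟨(0, j), le_refl (0 : ℤ), rfl⟩))
      have h3 : laurentBasis (k := k) w u (n, j)
          = algebraMap (RatFunc k) L RatFunc.X ^ n * laurentBasis (k := k) w u (0, j) := by
        simp [laurentBasis, Algebra.smul_def]
      rw [h3]
      refine mul_mem_integralSpace ?_ h2
      have m1 : algebraMap (RatFunc k) L RatFunc.X ∈ Algebra.adjoin k
          {algebraMap (RatFunc k) L RatFunc.X, (algebraMap (RatFunc k) L RatFunc.X)⁻¹} :=
        Algebra.subset_adjoin (by simp)
      have m2 : (algebraMap (RatFunc k) L RatFunc.X)⁻¹ ∈ Algebra.adjoin k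
          {algebraMap (RatFunc k) L RatFunc.X, (algebraMap (RatFunc k) L RatFunc.X)⁻¹} :=
        Algebra.subset_adjoin (by simp)
      obtain ⟨m, rfl | rfl⟩ := n.eq_nat_or_neg
      · rw [zpow_natCast]; exact pow_mem m1 m
      · rw [zpow_neg, zpow_natCast, ← inv_pow]; exact pow_mem m2 m

end Charts

/-! ### Čech cohomology and the genus. -/

section Genus

variable {k : Type*} [Field k] [IsAlgClosed k] [CharZero k]

/-- For a pole order m the missing exponents are those strictly between -m and 0; for m = 0, 2, 3, 5
there are 0, 1, 2, 4 of them. They index a basis of H¹. -/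
theorem compl_laurent_exponents :
    ({p : ℤ × Fin 4 | 0 ≤ p.1} ∪ {p | p.1 ≤ -(poleOrder p.2 : ℤ)})ᶜ
      = (({(-1, 1), (-1, 2), (-2, 2), (-1, 3), (-2, 3), (-3, 3), (-4, 3)} : Finset (ℤ × Fin 4)) :
        Set (ℤ × Fin 4)) := by
  ext ⟨n, j⟩
  fin_cases j <;> simp [poleOrder] <;> omega

theorem inter_laurent_exponents :
    ({p : ℤ × Fin 4 | 0 ≤ p.1} ∩ {p | p.1 ≤ -(poleOrder p.2 : ℤ)})
      = (({(0, 0)} : Finset (ℤ × Fin 4)) : Set (ℤ × Fin 4)) := by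
  ext ⟨n, j⟩
  fin_cases j <;> simp [poleOrder] <;> omega

theorem IsNondegenerate.definesCurveOfArithmeticGenus {φ ξ : k} (h : IsNondegenerate φ ξ) :
    DefinesCurveOfArithmeticGenus (curvePolyRat φ ξ) 7 := by
  have hirr := h.irreducible
  have := Fact.mk hirr
  have hfin := h.finrank_adjoinRoot
  set F := curvePolyRat φ ξ with hF
  have hc : 10 / φ ^ 5 ≠ 0 := div_ne_zero (by norm_num) (pow_ne_zero 5 (golden_ne_zero h.golden))
  have hy : aeval (AdjoinRoot.root F) F = 0 := by rw [AdjoinRoot.aeval_eq, AdjoinRoot.mk_self]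
  -- The quartic is even in y, so y ↦ -y defines the involution σ. It fixes w, which depends on y²,
  -- and negates u = xy/w.
  have hy' : aeval (-AdjoinRoot.root F) F = 0 := by
    refine (aeval_curvePolyRat (φ := φ) (ξ := ξ) (-AdjoinRoot.root F)).trans ?_
    rw [neg_sq]
    exact (aeval_curvePolyRat (φ := φ) (ξ := ξ) (AdjoinRoot.root F)).symm.trans hy
  obtain ⟨w, u, hw0, hw, hu, hwy, huy⟩ := h.exists_tower hy
  let σ : AdjoinRoot F →ₐ[RatFunc k] AdjoinRoot F :=
    AdjoinRoot.liftAlgHom F (Algebra.ofId _ _) (-AdjoinRoot.root F) hy'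
  have σy : σ (AdjoinRoot.root F) = -AdjoinRoot.root F := AdjoinRoot.liftAlgHom_root _ _ _ _
  have σc : ∀ p : k[X], σ (algebraMap k[X] (AdjoinRoot F) p) = algebraMap k[X] (AdjoinRoot F) p := by
    intro p
    rw [IsScalarTower.algebraMap_apply k[X] (RatFunc k) (AdjoinRoot F), AlgHom.commutes]
  have inj := algebraMap_polynomial_injective (k := k) (L := AdjoinRoot F)
  have σw : σ w = w := by
    have hden : algebraMap k[X] (AdjoinRoot F) (10 * C (2 * φ - 1) * hPoly φ ξ * gPoly φ ξ) ≠ 0 := by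
      intro h0
      have := inj (h0.trans (map_zero _).symm)
      simp only [mul_eq_zero, C_eq_zero, h.hPoly_ne_zero, h.gPoly_ne_zero,
        golden_sqrt_ne_zero h.golden, or_false] at this
      norm_num at this
    refine mul_right_cancel₀ hden ?_
    have := congrArg σ hwy
    simp only [map_mul σ, map_add σ, map_pow σ, σc, σy, map_ofNat σ, neg_sq] at this
    rw [this, hwy]
  have σu : σ u = -u := by
    refine mul_left_cancel₀ hw0 ?_
    have := congrArg σ huy
    simp only [map_mul σ, σc, σy, σw] at this
    rw [← this, mul_neg, huy, mul_neg]
  have hli := h.tower_linearIndependent hc hw hu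
  have : Module.Finite (RatFunc k) (AdjoinRoot F) := (AdjoinRoot.powerBasis hirr.ne_zero).finite
  have hspan : ∀ b : AdjoinRoot F, ∃ α β γ δ : RatFunc k, b = algebraMap (RatFunc k) _ α
      + algebraMap (RatFunc k) _ β * w
      + (algebraMap (RatFunc k) _ γ + algebraMap (RatFunc k) _ δ * w) * u := by
    intro b
    have hb := hli.span_eq_top_of_card_eq_finrank (by rw [hfin, Fintype.card_fin]) ▸
      Submodule.mem_top (x := b)
    obtain ⟨c, rfl⟩ := (Submodule.mem_span_range_iff_exists_fun _).mp hb
    refine ⟨c 0, c 1, c 2, c 3, ?_⟩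
    simp only [Fin.sum_univ_four, Algebra.smul_def]
    simp
    ring
  rw [IsScalarTower.algebraMap_apply k[X] (RatFunc k) (AdjoinRoot F)] at hw hu
  rw [IsScalarTower.algebraMap_apply k[X] (RatFunc k) (AdjoinRoot F)] at hu
  obtain ⟨c0, c1, c2⟩ := h.integralSpaces_eq_span hc hw hu σ σw σu hspan
  have he : LinearIndependent k (laurentBasis (k := k) w u) :=
    linearIndependent_smul linearIndependent_zpow_X hli
  have e0 : chartZero F = _ := c0
  have e1 : chartInfty F = _ := c1
  have e2 : chartOverlap F = _ := c2
  obtain ⟨f0, r0⟩ := finite_and_finrank_span_image he {(0, 0)}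
  obtain ⟨f1, r1⟩ := finite_and_finrank_span_quotient he _ _ compl_laurent_exponents
  rw [← inter_laurent_exponents, ← span_image_inf he, ← e0, ← e1] at f0 r0
  rw [← span_image_sup, ← e0, ← e1, ← e2] at f1 r1
  refine ⟨hirr, f0, f1, ?_⟩
  rw [r0, r1]
  rfl

end Genus

/-! ### Irreducibility in k[X][Y] and elimination of Y. -/

section Elimination

variable {k : Type*} [Field k] [CharZero k]

/-- A constant divisor divides the leading coefficient φ¹⁰X. It also divides the coefficient of Y⁰,
which is nonzero at X = 0 and hence coprime to X. -/
theorem IsNondegenerate.curvePoly_isPrimitive {φ ξ : k} (h : IsNondegenerate φ ξ) :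
    (curvePoly φ ξ).IsPrimitive := by
  have hφ := golden_ne_zero h.golden
  rw [isPrimitive_iff_isUnit_of_C_dvd]
  intro d hd
  rw [C_dvd_iff_dvd_coeff] at hd
  have e : curvePoly φ ξ = C (X * C (φ ^ 10)) * X ^ 4
      + C (2 * X * C (φ ^ 5) * (10 * fPoly φ ξ * gPoly φ ξ)) * X ^ 2
      + C (X * (10 * fPoly φ ξ * gPoly φ ξ) ^ 2 - 500 * hPoly φ ξ ^ 2 * gPoly φ ξ ^ 3) := by
    simp only [curvePoly, map_mul, map_sub, map_pow, map_ofNat]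
    ring
  have h4 := hd 4
  have h0 := hd 0
  rw [e] at h4 h0
  simp only [coeff_add, coeff_C_mul, coeff_X_pow, coeff_C] at h4 h0
  norm_num at h4 h0
  have hd0 : IsCoprime X (X * (10 * fPoly φ ξ * gPoly φ ξ) ^ 2
      - 500 * hPoly φ ξ ^ 2 * gPoly φ ξ ^ 3) := by
    rw [irreducible_X.coprime_iff_not_dvd, X_dvd_iff, coeff_zero_eq_eval_zero]
    simp [gPoly, hPoly, h.ne_zero]
  have hd4 : d ∣ X := by
    have hu : IsUnit (C φ ^ 10) := (isUnit_C.mpr hφ.isUnit).pow 10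
    exact (hu.dvd_mul_right).mp h4
  exact hd0.isUnit_of_dvd' hd4 h0

theorem IsNondegenerate.curvePoly_irreducible {φ ξ : k} (h : IsNondegenerate φ ξ) :
    Irreducible (curvePoly φ ξ) :=
  h.curvePoly_isPrimitive.irreducible_of_irreducible_map_of_injective
    (IsFractionRing.injective k[X] (RatFunc k)) h.irreducible

theorem IsNondegenerate.not_dvd_C {k : Type*} [Field k] {φ ξ : k} (h : IsNondegenerate φ ξ) {d : k[X]} (hd : d ≠ 0) :
    ¬ curvePoly φ ξ ∣ C d := by
  intro hdvd
  have h1 := natDegree_le_of_dvd hdvd (C_ne_zero.mpr hd)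
  have h2 := curvePoly_natDegree (ξ := ξ) (golden_ne_zero h.golden)
  rw [curvePolyRat, natDegree_map_eq_of_injective (IsFractionRing.injective k[X] (RatFunc k))] at h2
  rw [h2, natDegree_C] at h1
  omega

/-- A polynomial that is not a multiple of the equation of the curve has only finitely many
zeros on the curve. -/
theorem IsNondegenerate.exists_elimination {φ ξ : k} (h : IsNondegenerate φ ξ) {G : k[X][X]}
    (hG : ¬ curvePoly φ ξ ∣ G) :
    ∃ (A B : k[X][X]) (d : k[X]), d ≠ 0 ∧ A * curvePoly φ ξ + B * G = C d := by
  have hprime := h.curvePoly_irreducible.prime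
  have hinj : Function.Injective (map (algebraMap k[X] (RatFunc k))) :=
    map_injective _ (IsFractionRing.injective k[X] (RatFunc k))
  have hnd : ¬ curvePolyRat φ ξ ∣ G.map (algebraMap k[X] (RatFunc k)) := by
    rintro ⟨H, hH⟩
    obtain ⟨b, hb, hbH⟩ := IsLocalization.integerNormalization_spec (nonZeroDivisors k[X]) H
    have : C b * G = curvePoly φ ξ * IsLocalization.integerNormalization (nonZeroDivisors k[X]) H := by
      apply hinj
      rw [Polynomial.map_mul, Polynomial.map_mul, hbH, hH, curvePolyRat, map_C, ← smul_eq_C_mul,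
        mul_smul_comm, algebraMap_smul]
    rcases hprime.dvd_or_dvd (Dvd.intro _ this.symm) with h1 | h1
    · exact h.not_dvd_C (nonZeroDivisors.ne_zero hb) h1
    · exact hG h1
  obtain ⟨a, b, hab⟩ := (h.irreducible.coprime_iff_not_dvd).mpr hnd
  obtain ⟨c, hc, hca⟩ := IsLocalization.integerNormalization_spec (nonZeroDivisors k[X]) a
  obtain ⟨d, hd, hdb⟩ := IsLocalization.integerNormalization_spec (nonZeroDivisors k[X]) b
  refine ⟨C d * IsLocalization.integerNormalization (nonZeroDivisors k[X]) a,
    C c * IsLocalization.integerNormalization (nonZeroDivisors k[X]) b, c * d,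
    mul_ne_zero (nonZeroDivisors.ne_zero hc) (nonZeroDivisors.ne_zero hd), ?_⟩
  apply hinj
  simp only [Polynomial.map_add, Polynomial.map_mul, map_C, hca, hdb, map_mul]
  rw [← algebraMap_smul (RatFunc k) c, ← algebraMap_smul (RatFunc k) d b, smul_eq_C_mul,
    smul_eq_C_mul, ← curvePolyRat]
  linear_combination (C (algebraMap k[X] (RatFunc k) c) * C (algebraMap k[X] (RatFunc k) d)) * hab

end Elimination

/-! ### Polynomial identities of the flow. -/

section Identities

variable {k : Type*} [Field k]

/-- Up to the common factor 16√5 φ⁻¹ pqr, with φ⁻¹ = φ - 1, the flow on (P, Q, R) is the invariant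
field of the cubic. -/
theorem flow_identity {φ p q r : k} (hφ : φ ^ 2 = φ + 1) {v : k → k → k → k}
    (h : ∀ p q r, v p q r = -(5 - (2 * φ - 1)) * q * r ^ 5 - (5 + (2 * φ - 1)) * q ^ 5 * r
      + 20 * q ^ 3 * r ^ 3 - (10 + 10 * (2 * φ - 1)) * p ^ 2 * q * r ^ 3
      - (10 - 10 * (2 * φ - 1)) * p ^ 2 * q ^ 3 * r + 10 * p ^ 4 * q * r) :
    φ ^ 2 * (2 * p * v p q r) - 2 * q * v q r p
      = 16 * (2 * φ - 1) * (φ - 1) * (p * q * r) * ((φ ^ 2 * p ^ 2 - q ^ 2)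
        * ((φ ^ 2 * q ^ 2 - r ^ 2) - (φ ^ 2 * r ^ 2 - p ^ 2))) := by
  rw [h, h]
  grind

/-- This is the derivative of `linear_form_eq` along the flow after cancelling one factor p. It thus
keeps its content at p = 0, where it relates p' to tangency of the line. -/
theorem flow_identity_coordinate {φ p q r : k} (hφ : φ ^ 2 = φ + 1) {v : k → k → k → k}
    (h : ∀ p q r, v p q r = -(5 - (2 * φ - 1)) * q * r ^ 5 - (5 + (2 * φ - 1)) * q ^ 5 * r
      + 20 * q ^ 3 * r ^ 3 - (10 + 10 * (2 * φ - 1)) * p ^ 2 * q * r ^ 3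
      - (10 - 10 * (2 * φ - 1)) * p ^ 2 * q ^ 3 * r + 10 * p ^ 4 * q * r)
    {P Q R : k} (hP : P = φ ^ 2 * p ^ 2 - q ^ 2) (hQ : Q = φ ^ 2 * q ^ 2 - r ^ 2)
    (hR : R = φ ^ 2 * r ^ 2 - p ^ 2) :
    8 * φ ^ 3 * v p q r = 16 * (2 * φ - 1) * (φ - 1) * (q * r) *
      (φ ^ 4 * P * (Q - R) + φ ^ 2 * Q * (R - P) + R * (P - Q)) := by
  rw [h, hP, hQ, hR]
  grind

theorem linear_form_eq {φ p q r : k} (hφ : φ ^ 2 = φ + 1) :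
    φ ^ 4 * (φ ^ 2 * p ^ 2 - q ^ 2) + φ ^ 2 * (φ ^ 2 * q ^ 2 - r ^ 2) + (φ ^ 2 * r ^ 2 - p ^ 2)
      = 4 * φ ^ 3 * p ^ 2 := by
  grind

/-- The equation of the curve holds for `x = P` and `y = P'`. -/
theorem curve_equation {φ p q r ξ P Q R y : k} (hφ : φ ^ 2 = φ + 1)
    (hP : P = φ ^ 2 * p ^ 2 - q ^ 2) (hQ : Q = φ ^ 2 * q ^ 2 - r ^ 2)
    (hR : R = φ ^ 2 * r ^ 2 - p ^ 2) (hs : P + Q + R = φ) (hp : P * Q * R = ξ)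
    (hy : y = 16 * (2 * φ - 1) * (φ - 1) * (p * q * r) * (P * (Q - R))) :
    P * (y ^ 2 * φ ^ 5 + 10 * (fPoly φ ξ).eval P * (gPoly φ ξ).eval P) ^ 2
      = 500 * (hPoly φ ξ).eval P ^ 2 * (gPoly φ ξ).eval P ^ 3 := by
  have hφ0 := golden_ne_zero hφ
  have hg : (gPoly φ ξ).eval P = P * (Q - R) ^ 2 := by
    obtain rfl : R = φ - P - Q := by rw [← hs]; ring
    rw [← hp]
    simp [gPoly]
    ring
  have hs5 : (2 * φ - 1) ^ 2 = 5 := by linear_combination 4 * hφ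
  have hinv : (φ - 1) * φ = 1 := by linear_combination hφ
  have hid := elliptic_norm_identity hφ hs hp
  have l1 : φ ^ 4 * P + φ ^ 2 * Q + R = 4 * φ ^ 3 * p ^ 2 := by
    rw [hP, hQ, hR]; exact linear_form_eq hφ
  have l2 : φ ^ 4 * Q + φ ^ 2 * R + P = 4 * φ ^ 3 * q ^ 2 := by
    rw [hP, hQ, hR]; exact linear_form_eq hφ
  have l3 : φ ^ 4 * R + φ ^ 2 * P + Q = 4 * φ ^ 3 * r ^ 2 := by
    rw [hP, hQ, hR]; exact linear_form_eq hφ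
  rw [l1, l2, l3] at hid
  have hf : (fPoly φ ξ).eval P
      = 7 * φ * P ^ 3 - 7 * φ ^ 2 * P ^ 2 - (11 * ξ + 2 * φ ^ 3) * P - 7 * ξ * φ := by
    simp [fPoly]
  have hh : (hPoly φ ξ).eval P = 2 * P ^ 3 - φ * P ^ 2 + ξ := by simp [hPoly]
  rw [← hf, ← hh] at hid
  have hid' : (2 * φ - 1) * (hPoly φ ξ).eval P * (Q - R) - (fPoly φ ξ).eval P
      = 128 * φ ^ 3 * P * (p * q * r) ^ 2 := by
    refine mul_left_cancel₀ (pow_ne_zero 6 hφ0) ?_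
    linear_combination hid
  have hy2 : y ^ 2 * φ ^ 5 = 1280 * φ ^ 3 * P * (p * q * r) ^ 2 * (gPoly φ ξ).eval P := by
    rw [hy, hg]
    linear_combination 256 * (φ - 1) ^ 2 * (p * q * r) ^ 2 * (P * (Q - R)) ^ 2 * φ ^ 5 * hs5
      + 1280 * φ ^ 3 * (p * q * r) ^ 2 * (P * (Q - R)) ^ 2 * ((φ - 1) * φ + 1) * hinv
  have hW : y ^ 2 * φ ^ 5 + 10 * (fPoly φ ξ).eval P * (gPoly φ ξ).eval P
      = 10 * (2 * φ - 1) * (hPoly φ ξ).eval P * (Q - R) * (gPoly φ ξ).eval P := by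
    linear_combination hy2 - 10 * (gPoly φ ξ).eval P * hid'
  rw [hW]
  linear_combination 100 * P * ((hPoly φ ξ).eval P * (Q - R) * (gPoly φ ξ).eval P) ^ 2 * hs5
    - 500 * ((hPoly φ ξ).eval P) ^ 2 * (gPoly φ ξ).eval P ^ 2 * hg

end Identities

open Filter Topology

/-! ### Solutions of the real system and Zariski density. -/

section Real

theorem sqrt_five_eq : √5 = 2 * Real.goldenRatio - 1 := by
  unfold Real.goldenRatio; ring

theorem isNondegenerate_real {ξ : ℝ} (h1 : -((2 + √5) / 5) < ξ) (h2 : ξ < (2 + √5) / 27)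
    (h0 : ξ ≠ 0) : IsNondegenerate Real.goldenRatio ξ := by
  have hφ := Real.goldenRatio_sq
  have h3 : Real.goldenRatio ^ 3 = 2 + √5 := by
    rw [sqrt_five_eq]; linear_combination (Real.goldenRatio + 1) * hφ
  refine ⟨hφ, h0, ?_, ?_⟩ <;> rw [h3] <;> intro h <;> linarith

theorem IsSolution.rotate {ξ : ℝ} {I : Set ℝ} {p q r : ℝ → ℝ} (h : IsSolution ξ I p q r) :
    IsSolution ξ I q r p :=
  ⟨h.deriv_q, h.deriv_r, h.deriv_p, fun t ht => by rw [← h.sphere t ht]; ring,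
    fun t ht => by rw [← h.orbit t ht]; ring⟩

theorem rhs_eq (p q r : ℝ) : rhs p q r = -(5 - (2 * Real.goldenRatio - 1)) * q * r ^ 5
      - (5 + (2 * Real.goldenRatio - 1)) * q ^ 5 * r
      + 20 * q ^ 3 * r ^ 3 - (10 + 10 * (2 * Real.goldenRatio - 1)) * p ^ 2 * q * r ^ 3
      - (10 - 10 * (2 * Real.goldenRatio - 1)) * p ^ 2 * q ^ 3 * r + 10 * p ^ 4 * q * r := by
  rw [← sqrt_five_eq, rhs]

variable {ξ : ℝ} {I : Set ℝ} {p q r : ℝ → ℝ}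

theorem IsSolution.quadDiff_add (h : IsSolution ξ I p q r) {t : ℝ} (ht : t ∈ I) :
    quadDiff p q t + quadDiff q r t + quadDiff r p t = Real.goldenRatio := by
  simp only [quadDiff]
  linear_combination (Real.goldenRatio ^ 2 - 1) * h.sphere t ht + Real.goldenRatio_sq

theorem IsSolution.hasDerivAt_quadDiff (h : IsSolution ξ I p q r) {t : ℝ} (ht : t ∈ I) :
    HasDerivAt (quadDiff p q) (16 * (2 * Real.goldenRatio - 1) * (Real.goldenRatio - 1)
      * (p t * q t * r t) * (quadDiff p q t * (quadDiff q r t - quadDiff r p t))) t := by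
  have hd := (((h.deriv_p t ht).pow 2).const_mul (Real.goldenRatio ^ 2)).sub
    ((h.deriv_q t ht).pow 2)
  refine HasDerivAt.congr_deriv (f := quadDiff p q) hd ?_
  refine Eq.trans ?_ (flow_identity Real.goldenRatio_sq rhs_eq)
  norm_num

/-- Zeros of p are isolated because they are simple: p = p' = 0 would make the line φ⁴P + φ²Q + R =
0 tangent to the cubic. -/
theorem IsSolution.eventually_ne_zero (h : IsSolution ξ I p q r)
    (hn : IsNondegenerate Real.goldenRatio ξ) {t : ℝ} (ht : t ∈ I) :
    ∀ᶠ s in 𝓝[≠] t, p s ≠ 0 := by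
  by_cases hp : p t = 0
  · refine (h.deriv_p t ht).eventually_ne fun h0 => ?_
    have hq : q t ≠ 0 := by
      intro hq
      apply hn.ne_zero
      rw [← h.orbit t ht, hp, hq]; ring
    have hr : r t ≠ 0 := by
      intro hr
      apply hn.ne_zero
      rw [← h.orbit t ht, hp, hr]; ring
    have hid := flow_identity_coordinate Real.goldenRatio_sq rhs_eq (p := p t) (q := q t) (r := r t)
      rfl rfl rfl
    rw [h0, mul_zero, eq_comm] at hid
    have hφ1 : Real.goldenRatio - 1 ≠ 0 := sub_ne_zero.mpr Real.one_lt_goldenRatio.ne'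
    have hφ2 := golden_sqrt_ne_zero Real.goldenRatio_sq
    refine hn.not_tangent (h.quadDiff_add ht) (h.orbit t ht) ?_
      ((mul_eq_zero.mp hid).resolve_left (by positivity))
    simp only [quadDiff]
    rw [linear_form_eq Real.goldenRatio_sq, hp]; ring
  · exact ((h.deriv_p t ht).continuousAt.eventually_ne hp).filter_mono nhdsWithin_le_nhds

/-- If P' vanished throughout, then Q = R near a time with pqr ≠ 0. Differentiating Q - R there
gives P = Q = R = φ/3, that is, 27ξ = φ³. -/
theorem IsSolution.exists_deriv_ne_zero (h : IsSolution ξ I p q r)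
    (hn : IsNondegenerate Real.goldenRatio ξ) (hI : IsOpen I) (hne : I.Nonempty) :
    ∃ t ∈ I, deriv (quadDiff p q) t ≠ 0 := by
  by_contra! hzero
  have hφ1 : Real.goldenRatio - 1 ≠ 0 := sub_ne_zero.mpr Real.one_lt_goldenRatio.ne'
  have hφ2 := golden_sqrt_ne_zero Real.goldenRatio_sq
  obtain ⟨t₀, ht₀⟩ := hne
  obtain ⟨t, ht, hpt, hqt, hrt⟩ : ∃ t ∈ I, p t ≠ 0 ∧ q t ≠ 0 ∧ r t ≠ 0 :=
    ((Filter.Eventually.and (mem_nhdsWithin_of_mem_nhds (hI.mem_nhds ht₀))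
      ((h.eventually_ne_zero hn ht₀).and ((h.rotate.eventually_ne_zero hn ht₀).and
        (h.rotate.rotate.eventually_ne_zero hn ht₀)))).exists)
  have hP : ∀ s ∈ I, quadDiff p q s ≠ 0 := fun s hs h0 => hn.ne_zero (by
    rw [← h.orbit s hs]
    change quadDiff p q s * _ * _ = 0
    rw [h0]; ring)
  have hQ : quadDiff q r t ≠ 0 := fun h0 => hn.ne_zero (by
    rw [← h.orbit t ht]
    change _ * quadDiff q r t * _ = 0
    rw [h0]; ring)
  have hev : ∀ᶠ s in 𝓝 t, quadDiff q r s - quadDiff r p s = 0 := by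
    filter_upwards [hI.mem_nhds ht, (h.deriv_p t ht).continuousAt.eventually_ne hpt,
      (h.deriv_q t ht).continuousAt.eventually_ne hqt,
      (h.deriv_r t ht).continuousAt.eventually_ne hrt] with s hs hp hq hr
    have h1 := hzero s hs
    rw [(h.hasDerivAt_quadDiff hs).deriv] at h1
    simpa [hφ1, hφ2, hp, hq, hr, hP s hs] using h1
  have hd := ((h.rotate.hasDerivAt_quadDiff ht).sub (h.rotate.rotate.hasDerivAt_quadDiff ht)).unique
    ((hasDerivAt_const t (0 : ℝ)).congr_of_eventuallyEq hev)
  have hQR : quadDiff r p t = quadDiff q r t := (sub_eq_zero.mp hev.self_of_nhds).symm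
  rw [hQR] at hd
  have hPQ : quadDiff p q t = quadDiff q r t := by
    have : 32 * (2 * Real.goldenRatio - 1) * (Real.goldenRatio - 1) * (p t * q t * r t)
        * quadDiff q r t * (quadDiff q r t - quadDiff p q t) = 0 := by linear_combination hd
    have := (mul_eq_zero.mp this).resolve_left (by positivity)
    linarith
  have hs := h.quadDiff_add ht
  have ho : quadDiff p q t * quadDiff q r t * quadDiff r p t = ξ := h.orbit t ht
  rw [hQR, hPQ] at hs ho
  apply hn.ne_max
  rw [← ho, ← hs]; ring

theorem evalEval_curvePoly (φ ξ x y : ℝ) : (curvePoly φ ξ).evalEval x y =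
    x * (y ^ 2 * φ ^ 5 + 10 * (fPoly φ ξ).eval x * (gPoly φ ξ).eval x) ^ 2
      - 500 * (hPoly φ ξ).eval x ^ 2 * (gPoly φ ξ).eval x ^ 3 := by
  simp only [curvePoly, evalEval_sub, evalEval_mul, evalEval_pow, evalEval_add, evalEval_C,
    evalEval_X, eval_X, eval_mul, eval_pow, eval_C, eval_ofNat]

theorem IsSolution.curve_equation (h : IsSolution ξ I p q r) {t : ℝ} (ht : t ∈ I) :
    quadDiff p q t * (deriv (quadDiff p q) t ^ 2 * Real.goldenRatio ^ 5
        + 10 * (fPoly Real.goldenRatio ξ).eval (quadDiff p q t)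
          * (gPoly Real.goldenRatio ξ).eval (quadDiff p q t)) ^ 2
      = 500 * (hPoly Real.goldenRatio ξ).eval (quadDiff p q t) ^ 2
          * (gPoly Real.goldenRatio ξ).eval (quadDiff p q t) ^ 3 :=
  IcosahedralSuperflow.curve_equation Real.goldenRatio_sq rfl rfl rfl (h.quadDiff_add ht)
    (h.orbit t ht) (h.hasDerivAt_quadDiff ht).deriv

/-- If G were not a multiple of the equation, eliminating Y would confine P to the roots of a
nonzero polynomial. Near a time with P' ≠ 0 this is impossible. -/
theorem IsSolution.parametrizes (h : IsSolution ξ I p q r)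
    (hn : IsNondegenerate Real.goldenRatio ξ) (hI : IsOpen I) (hne : I.Nonempty) :
    Parametrizes I (quadDiff p q) (deriv (quadDiff p q)) (curvePoly Real.goldenRatio ξ) := by
  have hcurve : ∀ t ∈ I, (curvePoly Real.goldenRatio ξ).evalEval (quadDiff p q t)
      (deriv (quadDiff p q) t) = 0 := fun t ht => by
    rw [evalEval_curvePoly, h.curve_equation ht, sub_self]
  intro G
  constructor
  · intro hG
    by_contra hdvd
    obtain ⟨A, B, d, hd, hAB⟩ := hn.exists_elimination hdvd
    have hroot : ∀ t ∈ I, quadDiff p q t ∈ d.roots.toFinset := by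
      intro t ht
      have := congrArg (evalEval (quadDiff p q t) (deriv (quadDiff p q) t)) hAB
      rw [evalEval_add, evalEval_mul, evalEval_mul, hcurve t ht, hG t ht, evalEval_C] at this
      simpa [hd] using this.symm
    obtain ⟨t, ht, hdt⟩ := h.exists_deriv_ne_zero hn hI hne
    have hev : ∀ᶠ s in 𝓝[≠] t, ∀ c ∈ d.roots.toFinset, quadDiff p q s ≠ c :=
      (Filter.eventually_all_finset _).mpr fun c _ =>
        (differentiableAt_of_deriv_ne_zero hdt).hasDerivAt.eventually_ne hdt
    obtain ⟨s, hs, hsI⟩ := (hev.and (mem_nhdsWithin_of_mem_nhds (hI.mem_nhds ht))).exists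
    exact hs _ (hroot s hsI) rfl
  · rintro ⟨H, rfl⟩ t ht
    rw [evalEval_mul, hcurve t ht, zero_mul]

end Real

theorem C_mul_X_ne_C {k : Type*} [Field k] {a : k} (ha : a ≠ 0) (b : k) :
    RatFunc.C a * RatFunc.X ≠ RatFunc.C b := by
  rw [← RatFunc.algebraMap_C, ← RatFunc.algebraMap_C, ← RatFunc.algebraMap_X, ← map_mul]
  intro h
  have := congrArg (fun p => p.coeff 1) (IsFractionRing.injective k[X] (RatFunc k) h)
  simp [ha] at this

/-- The excluded values of ξ are constants of ℚ(φ), and the indeterminate is not a constant. -/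
theorem isNondegenerate_generic : IsNondegenerate genericPhi (RatFunc.X : GenericField) := by
  refine ⟨?_, RatFunc.X_ne_zero, ?_, ?_⟩
  · rw [genericPhi, ← map_pow, ← map_one RatFunc.C, ← map_add]
    exact congrArg _ (Subtype.ext Real.goldenRatio_sq)
  · rw [genericPhi, ← map_pow, ← map_ofNat RatFunc.C]
    exact C_mul_X_ne_C (by norm_num) _
  · rw [genericPhi, ← map_pow, ← map_neg, ← map_ofNat RatFunc.C]
    exact C_mul_X_ne_C (by norm_num) _

theorem isNondegenerate_coeffField {ξ : ℝ} (h : IsNondegenerate Real.goldenRatio ξ) :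
    IsNondegenerate (phiElt ξ) (xiElt ξ) :=
  IsNondegenerate.of_map (algebraMap (coeffField ξ) ℝ) h

theorem isNondegenerate_complex {ξ : ℝ} (h : IsNondegenerate Real.goldenRatio ξ) :
    IsNondegenerate (Real.goldenRatio : ℂ) (ξ : ℂ) :=
  h.map_ringHom Complex.ofRealHom

end IcosahedralSuperflow

theorem mainTheorem6 :
    -- each of the three pairs satisfies the equation, and parametrizes the curve if `ξ ≠ 0`
    (∀ ξ : ℝ, -((2 + √5) / 5) < ξ → ξ < (2 + √5) / 27 →
      ∀ (I : Set ℝ), IsOpen I → IsConnected I →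
      ∀ p q r : ℝ → ℝ, IcosahedralSuperflow.IsSolution ξ I p q r →
      ∀ x : ℝ → ℝ,
        (x = IcosahedralSuperflow.quadDiff p q ∨ x = IcosahedralSuperflow.quadDiff q r ∨
          x = IcosahedralSuperflow.quadDiff r p) →
        (∀ t ∈ I,
          x t * (deriv x t ^ 2 * Real.goldenRatio ^ 5
              + 10 * (IcosahedralSuperflow.fPoly Real.goldenRatio ξ).eval (x t)
                * (IcosahedralSuperflow.gPoly Real.goldenRatio ξ).eval (x t)) ^ 2
            = 500 * (IcosahedralSuperflow.hPoly Real.goldenRatio ξ).eval (x t) ^ 2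
                * (IcosahedralSuperflow.gPoly Real.goldenRatio ξ).eval (x t) ^ 3) ∧
        (ξ ≠ 0 → IcosahedralSuperflow.Parametrizes I x (deriv x)
          (IcosahedralSuperflow.curvePoly Real.goldenRatio ξ))) ∧
    -- irreducibility over `ℚ(φ, ξ)(X)`, for each nonzero `ξ` in the range
    (∀ ξ : ℝ, -((2 + √5) / 5) < ξ → ξ < (2 + √5) / 27 → ξ ≠ 0 →
      (IcosahedralSuperflow.curvePolyRat (IcosahedralSuperflow.phiElt ξ)
        (IcosahedralSuperflow.xiElt ξ)).natDegree = 4 ∧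
      Irreducible (IcosahedralSuperflow.curvePolyRat (IcosahedralSuperflow.phiElt ξ)
        (IcosahedralSuperflow.xiElt ξ))) ∧
    -- irreducibility over `ℚ(φ)(ξ, X)`, for `ξ` an indeterminate
    Irreducible (IcosahedralSuperflow.curvePolyRat IcosahedralSuperflow.genericPhi
      (RatFunc.X : IcosahedralSuperflow.GenericField)) ∧
    -- the arithmetic genus
    (∀ ξ : ℝ, -((2 + √5) / 5) < ξ → ξ < (2 + √5) / 27 → ξ ≠ 0 →
      IcosahedralSuperflow.DefinesCurveOfArithmeticGenus
        (IcosahedralSuperflow.curvePolyRat (Real.goldenRatio : ℂ) (ξ : ℂ)) 7) := by 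
  open IcosahedralSuperflow in
  refine ⟨fun ξ h1 h2 I hI hIc p q r h x hx => ?_, fun ξ h1 h2 h0 => ?_,
    isNondegenerate_generic.irreducible, fun ξ h1 h2 h0 => ?_⟩
  · rcases hx with rfl | rfl | rfl
    · exact ⟨fun t ht => h.curve_equation ht, fun h0 =>
        h.parametrizes (isNondegenerate_real h1 h2 h0) hI hIc.nonempty⟩
    · exact ⟨fun t ht => h.rotate.curve_equation ht, fun h0 =>
        h.rotate.parametrizes (isNondegenerate_real h1 h2 h0) hI hIc.nonempty⟩
    · exact ⟨fun t ht => h.rotate.rotate.curve_equation ht, fun h0 =>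
        h.rotate.rotate.parametrizes (isNondegenerate_real h1 h2 h0) hI hIc.nonempty⟩
  · have h := isNondegenerate_coeffField (isNondegenerate_real h1 h2 h0)
    exact ⟨curvePoly_natDegree (golden_ne_zero h.golden), h.irreducible⟩
  · exact (isNondegenerate_complex
      (isNondegenerate_real h1 h2 h0)).definesCurveOfArithmeticGenus
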